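/- **Setting.** Let $\mathbb K=\mathbb R$ or $\mathbb C$, let $V=V_0\oplus V_1$ be a super vector space over $\mathbb K$ with a homogeneous basis $(x^i)_{i\in I}$, $I$ linearly ordered, let $y_i\in V^*$ be the coordinate forms, and let $\widetilde V=V\oplus\mathbb K^{0|1}$, with one additional odd basis vector $x^0$; the index $a$ runs over $\{0\}\cup I$, ordered with $0$ first. Give $x^a$ and $\hbar\partial_a$ degree $1$ and $\hbar$ degree $2$. Let $\mathbb K[[\widetilde V,\hbar]]$ be the completed supercommutative algebra: series in the $x^a$ and the even variable $\hbar$ whose component of each degree is a polynomial; $\mathbb K[[\widetilde V]]$ is the subalgebra of series without $\hbar$. A superscript $\ge n$ or $\le n$ denotes the part in those degrees. Let $\widehat{\mathcal W}_\hbar(\widetilde V)$ be the completed Weyl algebra of operators $\sum_J c_J(x,\hbar)(\hbar\partial)^J$ on $\mathbb K[[\widetilde V,\hbar]]$, where $J$ runs over multi-indices in which odd indices occur at most once and $c_J\in\mathbb K[[\widetilde V,\hbar]]$ are arbitrary. Its classical limit $\mathrm{Cl}$ is the quotient map modulo $\hbar$, $\mathrm{Cl}\big(\sum_J c_J(x,\hbar)(\hbar\partial)^J\big)=\sum_J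 c_J(x,0)\,y^J$; likewise $\mathrm{Cl}(F)=F|_{\hbar=0}$ for $F\in\mathbb K[[\widetilde V,\hbar]]$. For $c=\sum_J c_J(x)y^J$ and $F\in\mathbb K[[\widetilde V]]^{\ge 3}$ let $c(x,dF)=\sum_J c_J\prod_a(\partial_aF)^{J_a}$, with $\partial_a$ the left derivative and products in increasing order of $a$ (for even $F$ this is the substitution $y_a=\partial_aF$). A *super quantum Airy structure* is a pair $(V,L)$ with $L:V^*\to\widehat{\mathcal W}_\hbar(\widetilde V)$ an even linear map, continuous for the topologies of pointwise convergence (on linear forms on $V$, with $\mathbb K$ discrete, and on operators on $\mathbb K[[\widetilde V,\hbar]]$, with its degree-adic topology), such that the left ideal $\mathfrak L\subseteq\widehat{\mathcal W}_\hbar(\widetilde V)$ generated by $L(V^*)$ satisfies $[\mathfrak L,\mathfrak L]\subseteq\hbar\,\mathfrak L$ for the super-commutator, and $L(y_i)^{\le1}=\hbar\partial_i$ for all $i\in I$. A *free energy* of $(V,L)$ is an even $F\in\mathbb K[[\widetilde V,\hbar]]^{\ge3}$, without terms independent of the $x^a$, such that $\psi_F(L(\phi))\cdot1=0$ for all $\phi\in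 V^*$, where $\psi_F(D)=\sum_{n\ge0}\frac1{n!}\big(-\frac1\hbar[F,\,\cdot\,]\big)^n(D)$. **Theorem.** Let $(V,L)$ be a super quantum Airy structure and $L_i^{\mathrm{cl}}=\mathrm{Cl}(L(y_i))$. There is a unique $F_{\mathrm{cl}}\in\mathbb K[[\widetilde V]]^{\ge3}$ such that $L_i^{\mathrm{cl}}(x,dF_{\mathrm{cl}})=0$ for all $i\in I$. Moreover $(V,L)$ has a unique free energy $F$, and $F_{\mathrm{cl}}=\mathrm{Cl}(F)$ (in particular $F_{\mathrm{cl}}$ is even). -/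

import Mathlib

open Finset

noncomputable section

namespace SuperAiry

/-!
`σ` indexes homogeneous linear coordinates `x^a` of a super vector space, `p a` is the parity of
`x^a`.  The ordered monomial `x^m ħ^k` is encoded by `(m, k)`, where `m : σ →₀ ℕ`.
-/

set_option linter.unusedSectionVars false

variable {𝕜 : Type*} [Field 𝕜] {σ : Type*} [LinearOrder σ] {p : σ → ZMod 2}

/-- An odd coordinate occurs at most once in a nonzero monomial. -/
def Admissible (p : σ → ZMod 2) (m : σ →₀ ℕ) : Prop := ∀ a, p a = 1 → m a ≤ 1

/-- The degree of `x^m ħ^k`: each `x^a` has degree one and `ħ` has degree two. -/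
def deg (μ : (σ →₀ ℕ) × ℕ) : ℕ := μ.1.degree + 2 * μ.2

/-- The `ℤ/2`-parity of the monomial `x^m`. -/
def monParity (p : σ → ZMod 2) (m : σ →₀ ℕ) : ZMod 2 := m.sum fun a n => (n : ZMod 2) * p a

/-- The sign in `x^m x^n = ± x^(m+n)`, monomials being written in increasing order of the index:
a factor `-1` for each odd `x^b` of the second that passes an odd `x^a`, `b < a`, of the first. -/
def koszul (p : σ → ZMod 2) (m n : σ →₀ ℕ) : ℤ :=
  (-1) ^ (m.sum fun a i => n.sum fun b j => if b < a ∧ p a = 1 ∧ p b = 1 then i * j else 0)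

variable (𝕜 p) in
/-- The completed supercommutative algebra `𝕜[[x, ħ]]`: families of coefficients of the monomials
`x^m ħ^k`, such that the component of each degree is a polynomial. -/
def Series : Submodule 𝕜 ((σ →₀ ℕ) × ℕ → 𝕜) where
  carrier := {f | (∀ μ, f μ ≠ 0 → Admissible p μ.1) ∧ ∀ d, {μ | f μ ≠ 0 ∧ deg μ = d}.Finite}
  zero_mem' := by simp
  add_mem' := by
    rintro f g ⟨hf, hf'⟩ ⟨hg, hg'⟩
    have key : ∀ μ, (f + g) μ ≠ 0 → f μ ≠ 0 ∨ g μ ≠ 0 := by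
      intro μ h
      by_contra! h'
      exact h (by simp [h'.1, h'.2])
    refine ⟨fun μ h => (key μ h).elim (hf μ) (hg μ), fun d => ?_⟩
    refine ((hf' d).union (hg' d)).subset ?_
    rintro μ ⟨h, hd⟩
    exact (key μ h).imp (fun h => ⟨h, hd⟩) (fun h => ⟨h, hd⟩)
  smul_mem' := by
    rintro c f ⟨hf, hf'⟩
    have key : ∀ μ, (c • f) μ ≠ 0 → f μ ≠ 0 := by
      intro μ h h'
      exact h (by simp [h'])
    exact ⟨fun μ h => hf μ (key μ h), fun d => (hf' d).subset fun μ h => ⟨key μ h.1, h.2⟩⟩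

/-- The coefficient of `x^m ħ^k`. -/
def coeff (μ : (σ →₀ ℕ) × ℕ) (f : Series 𝕜 p) : 𝕜 := f.1 μ

theorem Series.ext {f g : Series 𝕜 p} (h : ∀ μ, coeff μ f = coeff μ g) : f = g :=
  Subtype.ext (funext h)

theorem finite_deg_le (f : Series 𝕜 p) (d : ℕ) : {μ | f.1 μ ≠ 0 ∧ deg μ ≤ d}.Finite := by
  have : {μ | f.1 μ ≠ 0 ∧ deg μ ≤ d} = ⋃ e ∈ Set.Iic d, {μ | f.1 μ ≠ 0 ∧ deg μ = e} := by
    ext μ; simp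
  rw [this]
  exact (Set.finite_Iic d).biUnion fun e _ => f.2.2 e

/-- The unit series. -/
def one : Series 𝕜 p :=
  ⟨fun μ => if μ = 0 then 1 else 0, by
    refine ⟨fun μ h => ?_, fun d => (Set.finite_singleton 0).subset ?_⟩
    · have : μ = 0 := by by_contra h'; simp [h'] at h
      subst this
      intro a _
      simp
    · rintro μ ⟨h, -⟩
      by_contra h'
      simp_all⟩

/-- The coefficients of the supercommutative product. -/
def mulFun (p : σ → ZMod 2) (f g : (σ →₀ ℕ) × ℕ → 𝕜) (μ : (σ →₀ ℕ) × ℕ) : 𝕜 :=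
  open Classical in
  if Admissible p μ.1 then
    ∑ s ∈ antidiagonal μ.1, ∑ t ∈ antidiagonal μ.2,
      (koszul p s.1 s.2 : 𝕜) * f (s.1, t.1) * g (s.2, t.2)
  else 0

theorem mulFun_ne_zero {f g : (σ →₀ ℕ) × ℕ → 𝕜} {μ : (σ →₀ ℕ) × ℕ} (h : mulFun p f g μ ≠ 0) :
    Admissible p μ.1 ∧ ∃ α β, α + β = μ ∧ f α ≠ 0 ∧ g β ≠ 0 := by
  unfold mulFun at h
  split_ifs at h with hA
  · refine ⟨hA, ?_⟩
    obtain ⟨s, hs, h⟩ := exists_ne_zero_of_sum_ne_zero h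
    obtain ⟨t, ht, h⟩ := exists_ne_zero_of_sum_ne_zero h
    refine ⟨(s.1, t.1), (s.2, t.2), ?_, ?_, ?_⟩
    · rw [HasAntidiagonal.mem_antidiagonal] at hs ht
      exact Prod.ext hs ht
    · intro h0; simp [h0] at h
    · intro h0; simp [h0] at h
  · exact absurd rfl h

theorem deg_add (α β : (σ →₀ ℕ) × ℕ) : deg (α + β) = deg α + deg β := by
  simp [deg]; ring

/-- Left multiplication by a series. -/
def lmul (f : Series 𝕜 p) : Module.End 𝕜 (Series 𝕜 p) where
  toFun g := ⟨mulFun p f.1 g.1, fun μ h => (mulFun_ne_zero h).1, fun d => by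
    refine ((finite_deg_le f d).image2 (· + ·) (finite_deg_le g d)).subset ?_
    rintro μ ⟨h, rfl⟩
    obtain ⟨-, α, β, rfl, hα, hβ⟩ := mulFun_ne_zero h
    refine ⟨α, ⟨hα, ?_⟩, β, ⟨hβ, ?_⟩, rfl⟩ <;> simp [deg_add]⟩
  map_add' g h := by
    apply Subtype.ext; funext μ
    simp only [mulFun, Submodule.coe_add, Pi.add_apply]
    split_ifs <;> simp [mul_add, sum_add_distrib]
  map_smul' c g := by
    apply Subtype.ext; funext μ
    simp only [mulFun, Submodule.coe_smul, Pi.smul_apply, RingHom.id_apply, smul_eq_mul]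
    split_ifs
    · simp only [mul_sum]
      refine sum_congr rfl fun s _ => sum_congr rfl fun t _ => by ring
    · simp

/-- Multiplication by `ħ`. -/
def hbar : Module.End 𝕜 (Series 𝕜 p) where
  toFun f := ⟨fun μ => if μ.2 = 0 then 0 else f.1 (μ.1, μ.2 - 1), by
    refine ⟨fun μ h => ?_, fun d => ?_⟩
    · by_cases h0 : μ.2 = 0
      · simp [h0] at h
      · exact f.2.1 (μ.1, μ.2 - 1) (by simpa [h0] using h)
    · refine ((finite_deg_le f d).image fun μ => (μ.1, μ.2 + 1)).subset ?_
      rintro ⟨m, k⟩ ⟨h, rfl⟩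
      simp only at h
      split_ifs at h with h0
      · exact absurd rfl h
      · exact ⟨(m, k - 1), ⟨h, by simp [deg]⟩, Prod.ext rfl (by simp; omega)⟩⟩
  map_add' f g := by
    apply Subtype.ext; funext μ
    simp only [Submodule.coe_add, Pi.add_apply]
    split_ifs <;> simp
  map_smul' c f := by
    apply Subtype.ext; funext μ
    simp only [Submodule.coe_smul, Pi.smul_apply, RingHom.id_apply]
    split_ifs <;> simp

/-- Division by `ħ` of a series that is divisible by `ħ` (terms without `ħ` are dropped). -/
def divHbar : Module.End 𝕜 (Series 𝕜 p) where
  toFun f := ⟨fun μ => f.1 (μ.1, μ.2 + 1), by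
    refine ⟨fun μ h => f.2.1 (μ.1, μ.2 + 1) h, fun d => ?_⟩
    refine ((finite_deg_le f (d + 2)).preimage (f := fun μ => (μ.1, μ.2 + 1)) ?_).subset ?_
    · rintro ⟨m, k⟩ - ⟨m', k'⟩ - h
      simpa using h
    · rintro μ ⟨h, rfl⟩
      exact ⟨h, by simp [deg]; omega⟩⟩
  map_add' f g := rfl
  map_smul' c f := rfl

/-- The left derivative `∂_a`, with `∂_a x^b = δ_a^b + (-1)^(|a||b|) x^b ∂_a`. -/
def pd (a : σ) : Module.End 𝕜 (Series 𝕜 p) where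
  toFun f := ⟨fun μ => ((μ.1 a : 𝕜) + 1) * (koszul p (Finsupp.single a 1) μ.1 : 𝕜) *
      f.1 (μ.1 + Finsupp.single a 1, μ.2), by
    refine ⟨fun μ h b hb => ?_, fun d => ?_⟩
    · have := f.2.1 _ (right_ne_zero_of_mul h) b hb
      simp only [Finsupp.add_apply] at this
      omega
    · refine ((finite_deg_le f (d + 1)).preimage
        (f := fun μ => (μ.1 + Finsupp.single a 1, μ.2)) ?_).subset ?_
      · rintro ⟨m, k⟩ - ⟨m', k'⟩ - h
        simpa using h
      · rintro μ ⟨h, rfl⟩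
        exact ⟨right_ne_zero_of_mul h, by simp [deg]; omega⟩⟩
  map_add' f g := by
    apply Subtype.ext; funext μ
    simp [mul_add]
  map_smul' c f := by
    apply Subtype.ext; funext μ
    simp
    ring

/-- The parity involution of `𝕜[[x, ħ]]`: `+1` on even series, `-1` on odd ones. -/
def parityOp : Module.End 𝕜 (Series 𝕜 p) where
  toFun f := ⟨fun μ => (if monParity p μ.1 = 0 then 1 else -1) * f.1 μ, by
    exact ⟨fun μ h => f.2.1 _ (right_ne_zero_of_mul h), fun d => (f.2.2 d).subset
      fun μ h => ⟨right_ne_zero_of_mul h.1, h.2⟩⟩⟩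
  map_add' f g := by
    apply Subtype.ext; funext μ
    simp [mul_add]
  map_smul' c f := by
    apply Subtype.ext; funext μ
    simp

/-- The super-commutator of operators on `𝕜[[x, ħ]]`: the bilinear map which equals
`S T - (-1)^(|S||T|) T S` for homogeneous `S`, `T`.  Here the even and odd parts of `T` are
`(T ± P T P) / 2`, with `P` the parity involution. -/
def superComm (S T : Module.End 𝕜 (Series 𝕜 p)) : Module.End 𝕜 (Series 𝕜 p) :=
  S * T - ((2⁻¹ : 𝕜) • (T + parityOp * T * parityOp) * S +
    (2⁻¹ : 𝕜) • (T - parityOp * T * parityOp) * (parityOp * S * parityOp))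

variable (𝕜 p) in
/-- The completed Weyl algebra.  An element is the family of its normally ordered coefficients:
`c` stands for `∑_J c_J(x, ħ) (ħ∂)^J`, where `(ħ∂)^J` is the product of the `(ħ∂_a)^(J_a)` in
increasing order of `a`, and the `c_J` are arbitrary elements of `𝕜[[x, ħ]]`. -/
abbrev Weyl : Type _ := {J : σ →₀ ℕ // Admissible p J} → Series 𝕜 p

/-- The product of the `(T_a)^(J_a)`, in increasing order of `a`. -/
def orderedPow (T : σ → Module.End 𝕜 (Series 𝕜 p)) (J : σ →₀ ℕ) : Module.End 𝕜 (Series 𝕜 p) :=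
  ((J.support.sort (· ≤ ·)).map fun a => T a ^ J a).prod

theorem hbar_pd_pow_ne_zero (a : σ) (n : ℕ) (f : Series 𝕜 p) (ν : (σ →₀ ℕ) × ℕ)
    (h : (((hbar * pd a : Module.End 𝕜 (Series 𝕜 p)) ^ n) f).1 ν ≠ 0) :
    ∃ k, f.1 (ν.1 + n • Finsupp.single a 1, k) ≠ 0 ∧ k ≤ ν.2 ∧ k + n = ν.2 := by
  induction n generalizing ν with
  | zero => exact ⟨ν.2, by simpa using h, le_rfl, rfl⟩
  | succ n ih =>
    rw [pow_succ', Module.End.mul_apply, Module.End.mul_apply] at h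
    simp only [hbar, pd, LinearMap.coe_mk, AddHom.coe_mk] at h
    split_ifs at h with h0
    · exact absurd rfl h
    · obtain ⟨k, hk, hk', hk''⟩ := ih _ (right_ne_zero_of_mul h)
      refine ⟨k, ?_, by simp at hk'; omega, by simp at hk''; omega⟩
      rw [succ_nsmul', ← add_assoc]
      exact hk

theorem orderedPow_hbar_pd_ne_zero (J : σ →₀ ℕ) (f : Series 𝕜 p) (ν : (σ →₀ ℕ) × ℕ)
    (h : (orderedPow (fun a => (hbar * pd a : Module.End 𝕜 (Series 𝕜 p))) J f).1 ν ≠ 0) :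
    ∃ κ, f.1 κ ≠ 0 ∧ J ≤ κ.1 ∧ deg κ ≤ deg ν := by
  have key : ∀ (l : List σ) (ν : (σ →₀ ℕ) × ℕ),
      ((l.map fun a => (hbar * pd a : Module.End 𝕜 (Series 𝕜 p)) ^ J a).prod f).1 ν ≠ 0 →
      ∃ k, f.1 (ν.1 + (l.map fun a => J a • Finsupp.single a 1).sum, k) ≠ 0 ∧
        k + (l.map fun a => J a).sum = ν.2 := by
    intro l
    induction l with
    | nil => intro ν h; exact ⟨ν.2, by simpa using h, by simp⟩
    | cons a l ih =>
      intro ν h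
      rw [List.map_cons, List.prod_cons, Module.End.mul_apply] at h
      obtain ⟨k, hk, -, hk'⟩ := hbar_pd_pow_ne_zero a _ _ _ h
      obtain ⟨k₂, hk₂, hk₂'⟩ := ih _ hk
      refine ⟨k₂, ?_, ?_⟩
      · rw [List.map_cons, List.sum_cons, ← add_assoc]
        exact hk₂
      · rw [List.map_cons, List.sum_cons]
        simp only at hk₂'
        omega
  have hsum : ∀ {M : Type} [AddCommMonoid M] (g : σ → M),
      ((J.support.sort (· ≤ ·)).map g).sum = ∑ a ∈ J.support, g a := by
    intro M _ g
    rw [Finset.sum_list_map_count, Finset.sort_toFinset]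
    refine Finset.sum_congr rfl fun a ha => ?_
    rw [List.count_eq_one_of_mem (Finset.sort_nodup _ _) ((Finset.mem_sort _).2 ha), one_smul]
  obtain ⟨k, hk, hk'⟩ := key _ _ h
  have e : ((J.support.sort (· ≤ ·)).map fun a => J a • Finsupp.single a 1).sum = J := by
    have h1 : ((J.support.sort (· ≤ ·)).map fun a => J a • Finsupp.single a 1).sum
        = ∑ a ∈ J.support, J a • Finsupp.single a 1 := by
      rw [Finset.sum_list_map_count, Finset.sort_toFinset]
      refine Finset.sum_congr rfl fun a ha => ?_
      rw [List.count_eq_one_of_mem (Finset.sort_nodup _ _) ((Finset.mem_sort _).2 ha), one_smul]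
    rw [h1]
    simpa [Finsupp.sum] using Finsupp.sum_single J
  rw [hsum] at hk'
  rw [e] at hk
  refine ⟨_, hk, by simp, ?_⟩
  have : J.degree = ∑ a ∈ J.support, J a := rfl
  simp only [deg, map_add]
  omega

theorem finite_normal_terms (c : Weyl 𝕜 p) (f : Series 𝕜 p) (d : ℕ) :
    {J | ∃ μ, deg μ ≤ d ∧
      (lmul (c J) (orderedPow (fun a => hbar * pd a) J.1 f)).1 μ ≠ 0}.Finite := by
  have hfin : (⋃ κ ∈ {κ | f.1 κ ≠ 0 ∧ deg κ ≤ d}, Set.Iic κ.1).Finite :=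
    (finite_deg_le f d).biUnion fun κ _ => Set.finite_Iic κ.1
  refine (hfin.preimage (f := Subtype.val) Subtype.val_injective.injOn).subset ?_
  rintro J ⟨μ, hμ, h⟩
  obtain ⟨-, α, β, rfl, -, hβ⟩ := mulFun_ne_zero h
  obtain ⟨κ, hκ, hJ, hd⟩ := orderedPow_hbar_pd_ne_zero _ _ _ hβ
  rw [deg_add] at hμ
  simp only [Set.mem_preimage, Set.mem_iUnion]
  exact ⟨κ, ⟨hκ, by omega⟩, hJ⟩

theorem finite_normal_support (c : Weyl 𝕜 p) (f : Series 𝕜 p) (μ : (σ →₀ ℕ) × ℕ) :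
    (Function.support fun J =>
      (lmul (c J) (orderedPow (fun a => hbar * pd a) J.1 f)).1 μ).Finite :=
  (finite_normal_terms c f (deg μ)).subset fun _ h => ⟨μ, le_rfl, h⟩

theorem exists_of_finsum_ne_zero {α : Type*} {f : α → 𝕜} (h : ∑ᶠ a, f a ≠ 0) : ∃ a, f a ≠ 0 := by
  by_contra! h'
  exact h (by simp [h'])

/-- The operator `f ↦ ∑_J c_J (ħ∂)^J f` on `𝕜[[x, ħ]]` given by an element of the completed Weyl
algebra; each coefficient of the result is a finite sum. -/
def op (c : Weyl 𝕜 p) : Module.End 𝕜 (Series 𝕜 p) where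
  toFun f := ⟨fun μ => ∑ᶠ J, (lmul (c J) (orderedPow (fun a => hbar * pd a) J.1 f)).1 μ, by
    refine ⟨fun μ h => ?_, fun d => ?_⟩
    · obtain ⟨J, hJ⟩ := exists_of_finsum_ne_zero h
      exact (lmul (c J) _).2.1 μ hJ
    · refine ((finite_normal_terms c f d).biUnion fun J _ => (lmul (c J)
        (orderedPow (fun a => hbar * pd a) J.1 f)).2.2 d).subset ?_
      rintro μ ⟨h, hd⟩
      obtain ⟨J, hJ⟩ := exists_of_finsum_ne_zero h
      simp only [Set.mem_iUnion]
      exact ⟨J, ⟨μ, hd.le, hJ⟩, hJ, hd⟩⟩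
  map_add' f g := by
    apply Subtype.ext; funext μ
    simp only [map_add, Submodule.coe_add, Pi.add_apply]
    exact finsum_add_distrib (finite_normal_support c f μ) (finite_normal_support c g μ)
  map_smul' r f := by
    apply Subtype.ext; funext μ
    simp only [map_smul, Submodule.coe_smul, Pi.smul_apply, RingHom.id_apply]
    exact (smul_finsum r _).symm

/-- The part of degree at most `n` of a series. -/
def truncSeries (n : ℕ) (f : Series 𝕜 p) : Series 𝕜 p :=
  ⟨fun μ => if deg μ ≤ n then f.1 μ else 0, by
    have key : ∀ μ, (if deg μ ≤ n then f.1 μ else 0) ≠ 0 → f.1 μ ≠ 0 := by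
      intro μ h h'
      simp [h'] at h
    exact ⟨fun μ h => f.2.1 _ (key μ h), fun d => (f.2.2 d).subset fun μ h => ⟨key μ h.1, h.2⟩⟩⟩

/-- The part `D^(≤ n)` of an element of the completed Weyl algebra, `ħ∂_a` having degree one. -/
def truncWeyl (n : ℕ) (c : Weyl 𝕜 p) : Weyl 𝕜 p := fun J =>
  if J.1.degree ≤ n then truncSeries (n - J.1.degree) (c J) else 0

/-- The element `ħ∂_a` of the completed Weyl algebra. -/
def hbarPd (a : σ) : Weyl 𝕜 p := fun J => if J.1 = Finsupp.single a 1 then one else 0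

/-- `c` is homogeneous of `ℤ/2`-parity `α`. -/
def HasParity (α : ZMod 2) (c : Weyl 𝕜 p) : Prop :=
  ∀ J μ, coeff μ (c J) ≠ 0 → monParity p μ.1 + monParity p J.1 = α

/-- The quotient map `𝕜[[x, ħ]] → 𝕜[[x]]` modulo `ħ`, with `𝕜[[x]]` embedded in `𝕜[[x, ħ]]` as
the series that do not contain `ħ`. -/
def clSeries (f : Series 𝕜 p) : Series 𝕜 p :=
  ⟨fun μ => if μ.2 = 0 then f.1 μ else 0, by
    have key : ∀ μ, (if μ.2 = 0 then f.1 μ else 0) ≠ 0 → f.1 μ ≠ 0 := by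
      intro μ h h'
      simp [h'] at h
    exact ⟨fun μ h => f.2.1 _ (key μ h), fun d => (f.2.2 d).subset fun μ h => ⟨key μ h.1, h.2⟩⟩⟩

/-- The classical limit `Cl`, the quotient map of the completed Weyl algebra modulo `ħ`.
The class of `∑_J c_J(x, ħ) (ħ∂)^J` is written `∑_J c_J(x, 0) y^J`, a family of elements of
`𝕜[[x]]` indexed by the monomials in `y`. -/
def cl (c : Weyl 𝕜 p) : Weyl 𝕜 p := fun J => clSeries (c J)

/-- The fibres of `cl` are the cosets of `ħ` times the completed Weyl algebra. -/
theorem cl_eq_cl_iff (c c' : Weyl 𝕜 p) :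
    cl c = cl c' ↔ ∃ b : Weyl 𝕜 p, ∀ J, c J = c' J + hbar (b J) := by
  constructor
  · intro h
    refine ⟨fun J => divHbar (c J - c' J), fun J => Series.ext ?_⟩
    rintro ⟨m, k⟩
    have h1 : coeff (m, k) (cl c J) = coeff (m, k) (cl c' J) := by rw [h]
    simp only [coeff, cl, clSeries, hbar, divHbar, Submodule.coe_add, Pi.add_apply,
      LinearMap.coe_mk, AddHom.coe_mk, Submodule.coe_sub, Pi.sub_apply] at h1 ⊢
    rcases k with _ | k
    · simpa using h1
    · simp
  · rintro ⟨b, hb⟩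
    funext J
    refine Series.ext fun μ => ?_
    simp only [coeff, cl, clSeries, hb J, hbar, Submodule.coe_add, Pi.add_apply,
      LinearMap.coe_mk, AddHom.coe_mk]
    split_ifs <;> simp

/-- The series `c(x, dF) = ∑_J c_J (∂F)^J`, obtained from `c = ∑_J c_J(x) y^J` by substituting
`y_a = ∂_a F`; the product of the `(∂_a F)^(J_a)` is taken in increasing order of `a`. -/
def substD (c : Weyl 𝕜 p) (F : Series 𝕜 p) (μ : (σ →₀ ℕ) × ℕ) : 𝕜 :=
  ∑ᶠ J, coeff μ (lmul (c J) (orderedPow (fun a => lmul (pd a F)) J.1 one))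

/-- The sum in `substD` is finite when all terms of `F` have degree at least two. -/
theorem finite_substD (c : Weyl 𝕜 p) (F : Series 𝕜 p) (hF : ∀ μ, coeff μ F ≠ 0 → 2 ≤ deg μ)
    (μ : (σ →₀ ℕ) × ℕ) : (Function.support fun J =>
      coeff μ (lmul (c J) (orderedPow (fun a => lmul (pd a F)) J.1 one))).Finite := by
  have pow : ∀ (a : σ) (n : ℕ) (g : Series 𝕜 p) (ν : (σ →₀ ℕ) × ℕ),
      (((lmul (pd a F)) ^ n) g).1 ν ≠ 0 → ∃ κ, g.1 κ ≠ 0 ∧ deg κ + n ≤ deg ν ∧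
        (n ≠ 0 → ∃ τ, F.1 τ ≠ 0 ∧ τ.1 a ≠ 0 ∧ deg τ ≤ deg ν + 1) := by
    intro a n g
    induction n with
    | zero => intro ν h; exact ⟨ν, by simpa using h, le_rfl, fun h => absurd rfl h⟩
    | succ n ih =>
      intro ν h
      rw [pow_succ', Module.End.mul_apply] at h
      obtain ⟨-, α, β, rfl, hα, hβ⟩ := mulFun_ne_zero h
      obtain ⟨κ, hκ, hd, -⟩ := ih β hβ
      have hF' := right_ne_zero_of_mul hα
      have h2 := hF _ hF'
      have e : deg (α.1 + Finsupp.single a 1, α.2) = deg α + 1 := by simp [deg]; omega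
      rw [e] at h2
      rw [deg_add]
      exact ⟨κ, hκ, by omega, fun _ => ⟨_, hF', by simp, by omega⟩⟩
  have key : ∀ (J : σ →₀ ℕ) (l : List σ) (ν : (σ →₀ ℕ) × ℕ),
      ((l.map fun a => (lmul (pd a F)) ^ J a).prod one).1 ν ≠ 0 → ∀ a ∈ l,
        J a ≤ deg ν ∧ (J a ≠ 0 → ∃ τ, F.1 τ ≠ 0 ∧ τ.1 a ≠ 0 ∧ deg τ ≤ deg ν + 1) := by
    intro J l
    induction l with
    | nil => simp
    | cons b l ih =>
      intro ν h a ha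
      rw [List.map_cons, List.prod_cons, Module.End.mul_apply] at h
      obtain ⟨κ, hκ, hd, hτ⟩ := pow _ _ _ _ h
      rcases List.mem_cons.1 ha with rfl | ha
      · exact ⟨by omega, hτ⟩
      · obtain ⟨h1, h2⟩ := ih κ hκ a ha
        refine ⟨by omega, fun h0 => ?_⟩
        obtain ⟨τ, h3, h4, h5⟩ := h2 h0
        exact ⟨τ, h3, h4, by omega⟩
  have hS : (⋃ τ ∈ {τ | F.1 τ ≠ 0 ∧ deg τ ≤ deg μ + 1}, (τ.1.support : Set σ)).Finite :=
    (finite_deg_le F (deg μ + 1)).biUnion fun τ _ => τ.1.support.finite_toSet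
  refine ((Set.finite_Iic (∑ a ∈ hS.toFinset, Finsupp.single a (deg μ))).preimage
    (f := Subtype.val) Subtype.val_injective.injOn).subset ?_
  rintro J h
  obtain ⟨-, α, β, rfl, -, hβ⟩ := mulFun_ne_zero h
  rw [Set.mem_preimage, Set.mem_Iic, Finsupp.le_def]
  intro a
  by_cases ha : J.1 a = 0
  · simp [ha]
  · obtain ⟨h1, h2⟩ := key _ _ _ hβ a (by simpa using ha)
    obtain ⟨τ, h3, h4, h5⟩ := h2 ha
    have hmem : a ∈ hS.toFinset := by
      simp only [Set.Finite.mem_toFinset, Set.mem_iUnion]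
      exact ⟨τ, ⟨h3, by rw [deg_add]; omega⟩, by simpa using h4⟩
    rw [Finsupp.finsetSum_apply]
    refine le_trans ?_ (Finset.single_le_sum (f := fun b => Finsupp.single b (deg (α + β)) a)
      (fun _ _ => Nat.zero_le _) hmem)
    simp only [Finsupp.single_eq_same, deg_add]
    omega

/-- The automorphism `ψ_F(D) = ∑_n (1/n!) (-(1/ħ) [F, ·])^n (D)`, applied to `f`. -/
def psi (F : Series 𝕜 p) (D : Module.End 𝕜 (Series 𝕜 p)) (f : Series 𝕜 p)
    (μ : (σ →₀ ℕ) × ℕ) : 𝕜 :=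
  ∑ᶠ n : ℕ, (n.factorial : 𝕜)⁻¹ *
    coeff μ (((fun T => -(divHbar * superComm (lmul F) T))^[n] D) f)

/-- The sum in `psi` is finite when `D` is in the completed Weyl algebra and all terms of `F` have
degree at least three: the `n`-th term raises degrees by at least `n`. -/
theorem finite_psi (F : Series 𝕜 p) (hF : ∀ μ, coeff μ F ≠ 0 → 3 ≤ deg μ) (c : Weyl 𝕜 p)
    (f : Series 𝕜 p) (μ : (σ →₀ ℕ) × ℕ) : (Function.support fun n : ℕ => (n.factorial : 𝕜)⁻¹ *
      coeff μ (((fun T => -(divHbar * superComm (lmul F) T))^[n] (op c)) f)).Finite := by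
  let R : ℕ → Module.End 𝕜 (Series 𝕜 p) → Prop := fun r T => ∀ (g : Series 𝕜 p) (d : ℕ),
    (∀ ν, g.1 ν ≠ 0 → d ≤ deg ν) → ∀ ν, (T g).1 ν ≠ 0 → d + r ≤ deg ν
  have hadd : ∀ r S T, R r S → R r T → R r (S + T) := by
    intro r S T hS hT g d hg ν h
    by_cases h' : (S g).1 ν = 0
    · refine hT g d hg ν fun h'' => h ?_
      simp [h', h'']
    · exact hS g d hg ν h'
  have hsmul : ∀ (r : ℕ) (a : 𝕜) T, R r T → R r (a • T) := by
    intro r a T hT g d hg ν h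
    exact hT g d hg ν fun h' => h (by simp [h'])
  have hsub : ∀ r S T, R r S → R r T → R r (S - T) := by
    intro r S T hS hT g d hg ν h
    by_cases h' : (S g).1 ν = 0
    · refine hT g d hg ν fun h'' => h ?_
      simp [h', h'']
    · exact hS g d hg ν h'
  have hmul : ∀ r s S T, R r S → R s T → R (s + r) (S * T) := by
    intro r s S T hS hT g d hg ν h
    have := hS (T g) (d + s) (hT g d hg) ν h
    omega
  have hP : R 0 parityOp := fun g d hg ν h => hg ν (right_ne_zero_of_mul h)
  have hL : R 3 (lmul F) := by
    intro g d hg ν h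
    obtain ⟨-, α, β, rfl, hα, hβ⟩ := mulFun_ne_zero h
    have h1 := hF α hα
    have h2 := hg β hβ
    rw [deg_add]
    omega
  have hop : R 0 (op c) := by
    intro g d hg ν h
    obtain ⟨J, hJ⟩ := exists_of_finsum_ne_zero h
    obtain ⟨-, α, β, rfl, -, hβ⟩ := mulFun_ne_zero hJ
    obtain ⟨κ, hκ, -, hd⟩ := orderedPow_hbar_pd_ne_zero _ _ _ hβ
    have := hg κ hκ
    rw [deg_add]
    omega
  have hconj : ∀ r T, R r T → R r (parityOp * T * parityOp) := by
    intro r T hT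
    simpa using hmul _ _ _ _ (hmul _ _ _ _ hP hT) hP
  have hcomm : ∀ r T, R r T → R (r + 3) (superComm (lmul F) T) := by
    intro r T hT
    refine hsub _ _ _ (hmul 3 r _ _ hL hT) (hadd _ _ _ ?_ ?_)
    · rw [Nat.add_comm]
      exact hmul r 3 _ _ (hsmul _ _ _ (hadd _ _ _ hT (hconj _ _ hT))) hL
    · rw [Nat.add_comm]
      exact hmul r 3 _ _ (hsmul _ _ _ (hsub _ _ _ hT (hconj _ _ hT))) (hconj _ _ hL)
  have hiter : ∀ n, R n ((fun T => -(divHbar * superComm (lmul F) T))^[n] (op c)) := by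
    intro n
    induction n with
    | zero => exact hop
    | succ n ih =>
      rw [Function.iterate_succ_apply']
      intro g d hg ν h
      have h' : (superComm (lmul F) ((fun T => -(divHbar * superComm (lmul F) T))^[n] (op c)) g).1
          (ν.1, ν.2 + 1) ≠ 0 := fun h' => h (by
        simp only [LinearMap.neg_apply, Submodule.coe_neg, Pi.neg_apply, neg_eq_zero]
        exact h')
      have := hcomm n _ ih g d hg _ h'
      simp only [deg] at this ⊢
      omega
  refine (Set.finite_Iic (deg μ)).subset fun n h => ?_
  have := hiter n f 0 (fun _ _ => Nat.zero_le _) μ (right_ne_zero_of_mul h)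
  simpa using this

/-- The parities of the coordinates of `Ṽ = V ⊕ 𝕜^{0|1}`: the extra coordinate `x^0`, with index
`⊥`, is odd. -/
def tilde {ι : Type*} (p : ι → ZMod 2) : WithBot ι → ZMod 2
  | none => 1
  | some i => p i

/-- The left ideal of the completed Weyl algebra generated by the image of `L`. -/
def leftIdeal {V : Type*} [AddCommGroup V] [Module 𝕜 V] (L : Module.Dual 𝕜 V →ₗ[𝕜] Weyl 𝕜 p) :
    Submodule 𝕜 (Module.End 𝕜 (Series 𝕜 p)) :=
  Submodule.span 𝕜 {T | ∃ (a : Weyl 𝕜 p) (φ : Module.Dual 𝕜 V), T = op a * op (L φ)}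

/-- `(V, L)` is a super quantum Airy structure.  Here `V = 𝒱 0 ⊕ 𝒱 1`, and `x` is a basis
of `V` consisting of homogeneous vectors, `x i` of parity `p i`. -/
structure IsSuperQuantumAiry {V : Type*} [AddCommGroup V] [Module 𝕜 V]
    (𝒱 : ZMod 2 → Submodule 𝕜 V) {ι : Type*} [LinearOrder ι] (x : Module.Basis ι 𝕜 V)
    (p : ι → ZMod 2) (L : Module.Dual 𝕜 V →ₗ[𝕜] Weyl 𝕜 (tilde p)) : Prop where
  /-- `L` preserves parity; `φ` has parity `α` if it vanishes on vectors of the other parity. -/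
  even : ∀ (α : ZMod 2) (φ : Module.Dual 𝕜 V), (∀ v ∈ 𝒱 (α + 1), φ v = 0) → HasParity α (L φ)
  /-- `L` is continuous for the topologies of pointwise convergence on `V*` (linear forms on `V`,
  with `𝕜` discrete) and on the completed Weyl algebra (operators on `𝕜[[Ṽ, ħ]]`). -/
  continuous : ∀ (f : Series 𝕜 (tilde p)) (n : ℕ), ∃ s : Finset V, ∀ φ : Module.Dual 𝕜 V,
    (∀ v ∈ s, φ v = 0) → ∀ μ, deg μ < n → coeff μ (op (L φ) f) = 0
  /-- The left ideal `𝔏` generated by the image of `L` satisfies `[𝔏, 𝔏] ⊆ ħ 𝔏`. -/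
  involutive : ∀ S ∈ leftIdeal L, ∀ T ∈ leftIdeal L, ∃ U ∈ leftIdeal L,
    superComm S T = hbar * U
  /-- `L(y_i)` equals `ħ∂_i` up to terms of degree at least two. -/
  linear_part : ∀ i, truncWeyl 1 (L (x.coord i)) = hbarPd (i : WithBot ι)

/-- `F` is a free energy of `L`: an even series without terms independent of the `x^a`, all of
whose terms have degree at least three, with `ψ_F(L(φ)) · 1 = 0` for all `φ`. -/
def IsFreeEnergy {V : Type*} [AddCommGroup V] [Module 𝕜 V]
    (L : Module.Dual 𝕜 V →ₗ[𝕜] Weyl 𝕜 p) (F : Series 𝕜 p) : Prop :=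
  (∀ μ, coeff μ F ≠ 0 → monParity p μ.1 = 0 ∧ μ.1 ≠ 0 ∧ 3 ≤ deg μ) ∧
    ∀ φ, psi F (op (L φ)) one = 0

/-- `F` belongs to `𝕜[[x]]^(≥ 3)` and solves the equations `L_i^cl(x, dF) = 0`, where
`L_i^cl = Cl(L(y_i))`. -/
def IsClassicalSolution {V : Type*} [AddCommGroup V] [Module 𝕜 V] {ι : Type*}
    (x : Module.Basis ι 𝕜 V) (L : Module.Dual 𝕜 V →ₗ[𝕜] Weyl 𝕜 p) (F : Series 𝕜 p) : Prop :=
  (∀ μ, coeff μ F ≠ 0 → μ.2 = 0 ∧ 3 ≤ deg μ) ∧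
    ∀ i, substD (cl (L (x.coord i))) F = 0

end SuperAiry

end

open Finset

noncomputable section

namespace SuperAiry

set_option linter.unusedSectionVars false

section

variable {𝕜 : Type*} [Field 𝕜] {σ : Type*} [LinearOrder σ] {p : σ → ZMod 2}

/-! ### Signs -/

/-! Write L_a for L(y_a), a ≠ 0. Formally ψ_F is conjugation by exp(F/ħ), so for even F it replaces
ħ∂_a by ħ∂_a + ∂_aF (`conj_hbar_pd`, `conj_op`). Let R_a = ψ_F(L_a)·1 be the residue. Since L_a is
ħ∂_a up to degree two, R_a is ∂_aF plus a remainder whose part of degree n depends only on the parts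
of F of degree at most n (`opG_sub_opG_mem_filt`). The equations R_a = 0 are thus an overdetermined
recursion for the gradient of F.

Contracting with the x^a, a ≠ 0, makes it determined. The Euler operator E = ∑ x^a∂_a multiplies a
monomial by its number of letters other than x^0. This number is nonzero on every monomial allowed
in F: as x^0 is odd, the only exceptions are ħ^k and x^0ħ^k, excluded respectively because F has no
terms independent of x and because F is even. Hence F ↦ F - E⁻¹ ∑ x^a R_a improves agreement by one
degree at each step (`nextPotential_sub_mem_filt`) and has exactly one fixed point.

A free energy is a fixed point. Conversely, ∑ x^a R_a = 0 at a fixed point, and involutivity does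
the rest (`residue_eq_zero`). If all R_a start in degree n, write [L_a, L_b] = ħU with U in the left
ideal, conjugate, and apply to 1. Since ψ_F(U)·1 also starts in degree n, ħ(∂_aR_b ∓ ∂_bR_a)
vanishes below degree n + 2: the lowest part of R is closed. Differentiating ∑ x^a R_a = 0 by x^b
then gives (E + 1)R_b = 0 in degree n, so R_b starts in degree n + 1 (`mem_filt_succ_of_closed`).
Continuity of L carries the bounds from the y_i to all linear forms, including those that occur in
U.

Modulo ħ, the substitution of ħ∂_a + ∂_aF becomes that of ∂_aF, so the classical limit of the free
energy solves the classical equations (`substD_cl`). Classical uniqueness needs neither evenness nor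
involutivity: a monomial of degree at least three without ħ contains a letter other than x^0, so the
partial derivatives determine F degree by degree.

Convergence and exactness of division are carried by `Conj`. As `divHbar` silently drops terms, the
conjugate is described by a flow that satisfies its recursion after multiplication by ħ; this makes
`Conj` stable under sums, products and pointwise limits. -/

theorem koszul_add_left (m m' n : σ →₀ ℕ) :
    koszul p (m + m') n = koszul p m n * koszul p m' n := by
  unfold koszul
  rw [← pow_add, Finsupp.sum_add_index']
  · intro a; simp
  · intro a i j
    rw [← Finsupp.sum_add]
    congr 1; ext b k
    split_ifs <;> ring

theorem koszul_add_right (m n n' : σ →₀ ℕ) :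
    koszul p m (n + n') = koszul p m n * koszul p m n' := by
  unfold koszul
  rw [← pow_add, ← Finsupp.sum_add]
  congr 2; ext a i
  rw [Finsupp.sum_add_index']
  · intro a; simp
  · intro a i j
    split_ifs <;> ring

@[simp] theorem koszul_zero_left (n : σ →₀ ℕ) : koszul p 0 n = 1 := by simp [koszul]

@[simp] theorem koszul_zero_right (n : σ →₀ ℕ) : koszul p n 0 = 1 := by simp [koszul]

theorem koszul_eq_or (m n : σ →₀ ℕ) : koszul p m n = 1 ∨ koszul p m n = -1 :=
  neg_one_pow_eq_or ℤ _

@[simp] theorem koszul_mul_self (m n : σ →₀ ℕ) : koszul p m n * koszul p m n = 1 := by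
  rcases koszul_eq_or (p := p) m n with h | h <;> simp [h]

theorem koszul_cast_mul_self (m n : σ →₀ ℕ) :
    (koszul p m n : 𝕜) * (koszul p m n : 𝕜) = 1 := by
  rw [← Int.cast_mul, koszul_mul_self, Int.cast_one]

theorem koszul_cast_ne_zero (m n : σ →₀ ℕ) : (koszul p m n : 𝕜) ≠ 0 := fun h => by
  simpa [h] using koszul_cast_mul_self (𝕜 := 𝕜) (p := p) m n

theorem zmod_two_cases (x : ZMod 2) : x = 0 ∨ x = 1 := by
  revert x; decide

theorem monParity_add (m n : σ →₀ ℕ) : monParity p (m + n) = monParity p m + monParity p n := by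
  unfold monParity
  rw [Finsupp.sum_add_index']
  · simp
  · intro a i j; push_cast; ring

@[simp] theorem monParity_zero : monParity p 0 = 0 := by simp [monParity]

@[simp] theorem monParity_single (a : σ) (n : ℕ) :
    monParity p (Finsupp.single a n) = n * p a := by
  simp [monParity]

/-- The sign of a parity. -/
def parSign (α : ZMod 2) : ℤ := if α = 0 then 1 else -1

theorem parSign_natCast (n : ℕ) : parSign (n : ZMod 2) = (-1) ^ n := by
  unfold parSign
  split_ifs with h
  · rw [(ZMod.natCast_eq_zero_iff_even.1 h).neg_one_pow]
  · rw [ZMod.natCast_eq_zero_iff_even, Nat.not_even_iff_odd] at h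
    rw [h.neg_one_pow]

/-- When x^b is odd, every odd letter of m is either smaller or larger than b, so the two exponents
together count each of them once. The hypothesis excludes the letter b itself, which neither
exponent would count. -/
theorem koszul_single_comm {b : σ} {m : σ →₀ ℕ} (h : p b = 1 → m b = 0) :
    koszul p m (Finsupp.single b 1) * koszul p (Finsupp.single b 1) m =
      parSign (p b * monParity p m) := by
  rcases zmod_two_cases (p b) with hb | hb
  · have h1 : koszul p m (Finsupp.single b 1) = 1 := by simp [koszul, hb]
    have h2 : koszul p (Finsupp.single b 1) m = 1 := by simp [koszul, hb]
    simp [h1, h2, hb, parSign]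
  · have hc : monParity p m = ((m.sum fun a i => if p a = 1 then i else 0 : ℕ) : ZMod 2) := by
      unfold monParity
      rw [Finsupp.sum, Finsupp.sum, Nat.cast_sum]
      refine sum_congr rfl fun a _ => ?_
      rcases zmod_two_cases (p a) with h | h <;> simp [h]
    rw [hb, one_mul, hc, parSign_natCast]
    unfold koszul
    rw [← pow_add]
    congr 1
    rw [Finsupp.sum_single_index (by simp), ← Finsupp.sum_add]
    refine Finsupp.sum_congr fun a ha => ?_
    have hab : p a = 1 → a ≠ b := by
      rintro h1 rfl
      exact (Finsupp.mem_support_iff.1 ha) (h h1)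
    rw [Finsupp.sum_single_index (by simp)]
    by_cases h1 : p a = 1
    · rcases lt_or_gt_of_ne (hab h1) with h2 | h2
      · simp [h1, hb, h2, h2.not_gt]
      · simp [h1, hb, h2, h2.not_gt]
    · simp [h1]

theorem koszul_single_comm_of_even {b : σ} {m : σ →₀ ℕ} (h : p b = 1 → m b = 0)
    (hm : monParity p m = 0) :
    koszul p m (Finsupp.single b 1) = koszul p (Finsupp.single b 1) m := by
  have := koszul_single_comm h
  rw [hm, mul_zero] at this
  rcases koszul_eq_or (p := p) m (Finsupp.single b 1) with h | h <;>
    rcases koszul_eq_or (p := p) (Finsupp.single b 1) m with h' | h' <;>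
    simp_all [parSign]

/-- Both signs are multiplicative in n, so the letters of n can be moved past the even monomial m
one at a time. -/
theorem koszul_comm_of_even {m n : σ →₀ ℕ} (hm : monParity p m = 0)
    (h : ∀ b, p b = 1 → n b ≠ 0 → m b = 0) : koszul p m n = koszul p n m := by
  induction n using Finsupp.induction_linear with
  | zero => simp
  | add f g hf hg =>
    rw [koszul_add_left, koszul_add_right, hf, hg]
    · intro b hb h0; exact h b hb (by simp [h0])
    · intro b hb h0; exact h b hb (by simp [h0])
  | single b j =>
    by_cases hj : j = 0
    · simp [hj]
    have key := koszul_single_comm_of_even (p := p) (b := b) (m := m)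
      (fun hb => h b hb (by simpa using hj)) hm
    clear h hj
    induction j with
    | zero => simp
    | succ j ih => rw [Finsupp.single_add, koszul_add_left, koszul_add_right, ih, key]

theorem Admissible.of_le {m n : σ →₀ ℕ} (h : Admissible p n) (hle : m ≤ n) : Admissible p m :=
  fun a ha => (hle a).trans (h a ha)

/-! ### The degree filtration -/

variable (𝕜 p) in
/-- The series all of whose terms have degree at least `d`. -/
def filt (d : ℕ) : Submodule 𝕜 (Series 𝕜 p) where
  carrier := {f | ∀ μ, deg μ < d → f.1 μ = 0}
  zero_mem' := fun _ _ => rfl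
  add_mem' := by
    intro f g hf hg μ h
    simp [hf μ h, hg μ h]
  smul_mem' := by
    intro c f hf μ h
    simp [hf μ h]

theorem mem_filt {d : ℕ} {f : Series 𝕜 p} : f ∈ filt 𝕜 p d ↔ ∀ μ, deg μ < d → f.1 μ = 0 :=
  Iff.rfl

theorem filt_anti {d e : ℕ} (h : d ≤ e) : filt 𝕜 p e ≤ filt 𝕜 p d :=
  fun _ hf μ hμ => hf μ (hμ.trans_le h)

@[simp] theorem mem_filt_zero (f : Series 𝕜 p) : f ∈ filt 𝕜 p 0 := fun _ h => absurd h (by simp)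

theorem mem_filt_iff_le {d : ℕ} {f : Series 𝕜 p} :
    f ∈ filt 𝕜 p d ↔ ∀ μ, coeff μ f ≠ 0 → d ≤ deg μ :=
  ⟨fun h μ hμ => not_lt.1 fun h' => hμ (h μ h'),
    fun h μ hμ => by_contra fun h' => absurd (h μ h') (not_le.2 hμ)⟩

theorem eq_zero_of_mem_filt {f : Series 𝕜 p} (h : ∀ d, f ∈ filt 𝕜 p d) : f = 0 :=
  Series.ext fun μ => h (deg μ + 1) μ (Nat.lt_succ_self _)

theorem eq_of_sub_mem_filt {f g : Series 𝕜 p} (h : ∀ d, f - g ∈ filt 𝕜 p d) : f = g :=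
  sub_eq_zero.1 (eq_zero_of_mem_filt h)

/-- `T` raises degrees by at least `r`. -/
def Raises (r : ℕ) (T : Module.End 𝕜 (Series 𝕜 p)) : Prop :=
  ∀ d, ∀ f ∈ filt 𝕜 p d, T f ∈ filt 𝕜 p (d + r)

theorem Raises.mono {r s : ℕ} {T : Module.End 𝕜 (Series 𝕜 p)} (h : Raises r T) (hs : s ≤ r) :
    Raises s T := fun d f hf => filt_anti (by omega) (h d f hf)

theorem Raises.apply {r : ℕ} {T : Module.End 𝕜 (Series 𝕜 p)} (h : Raises r T)
    (f : Series 𝕜 p) : T f ∈ filt 𝕜 p r := by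
  simpa using h 0 f (mem_filt_zero f)

theorem Raises.add {r : ℕ} {S T : Module.End 𝕜 (Series 𝕜 p)} (hS : Raises r S)
    (hT : Raises r T) : Raises r (S + T) :=
  fun d f hf => add_mem (hS d f hf) (hT d f hf)

theorem Raises.sub {r : ℕ} {S T : Module.End 𝕜 (Series 𝕜 p)} (hS : Raises r S)
    (hT : Raises r T) : Raises r (S - T) :=
  fun d f hf => sub_mem (hS d f hf) (hT d f hf)

theorem Raises.smul {r : ℕ} {T : Module.End 𝕜 (Series 𝕜 p)} (c : 𝕜) (hT : Raises r T) :
    Raises r (c • T) :=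
  fun d f hf => Submodule.smul_mem _ _ (hT d f hf)

theorem Raises.sum {α : Type*} {r : ℕ} {s : Finset α} {T : α → Module.End 𝕜 (Series 𝕜 p)}
    (hT : ∀ a ∈ s, Raises r (T a)) : Raises r (∑ a ∈ s, T a) := fun d f hf => by
  rw [LinearMap.sum_apply]
  exact sum_mem fun a ha => hT a ha d f hf

theorem Raises.mul {r s : ℕ} {S T : Module.End 𝕜 (Series 𝕜 p)} (hS : Raises r S)
    (hT : Raises s T) : Raises (r + s) (S * T) := fun d f hf => by
  have := hS _ _ (hT d f hf)
  rwa [add_assoc, add_comm s] at this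

theorem Raises.zero {r : ℕ} : Raises r (0 : Module.End 𝕜 (Series 𝕜 p)) :=
  fun _ _ _ => zero_mem _

theorem Raises.one : Raises 0 (1 : Module.End 𝕜 (Series 𝕜 p)) := fun _ _ hf => hf

theorem lmul_mem_filt {r d : ℕ} {f g : Series 𝕜 p} (hf : f ∈ filt 𝕜 p r) (hg : g ∈ filt 𝕜 p d) :
    lmul f g ∈ filt 𝕜 p (r + d) := by
  rw [mem_filt_iff_le]
  intro μ h
  obtain ⟨-, α, β, rfl, hα, hβ⟩ := mulFun_ne_zero h
  rw [mem_filt_iff_le] at hf hg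
  have := hf α hα
  have := hg β hβ
  rw [deg_add]
  omega

theorem raises_lmul {r : ℕ} {f : Series 𝕜 p} (hf : f ∈ filt 𝕜 p r) : Raises r (lmul f) :=
  fun d g hg => by
    rw [add_comm]
    exact lmul_mem_filt hf hg

theorem raises_hbar : Raises 2 (hbar : Module.End 𝕜 (Series 𝕜 p)) := by
  intro d f hf μ hμ
  simp only [hbar, LinearMap.coe_mk, AddHom.coe_mk]
  split_ifs with h
  · rfl
  · refine hf _ ?_
    simp only [deg] at hμ ⊢
    omega

theorem pd_mem_filt (a : σ) {d : ℕ} {f : Series 𝕜 p} (hf : f ∈ filt 𝕜 p (d + 1)) :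
    pd a f ∈ filt 𝕜 p d := by
  intro μ hμ
  simp only [pd, LinearMap.coe_mk, AddHom.coe_mk]
  rw [hf, mul_zero]
  simp [deg] at hμ ⊢
  omega

theorem divHbar_mem_filt {d : ℕ} {f : Series 𝕜 p} (hf : f ∈ filt 𝕜 p (d + 2)) :
    divHbar f ∈ filt 𝕜 p d := by
  intro μ hμ
  refine hf _ ?_
  simp only [deg] at hμ ⊢
  omega

theorem raises_hbar_pd (a : σ) : Raises 1 (hbar * pd a : Module.End 𝕜 (Series 𝕜 p)) := by
  intro d f hf
  rcases d with _ | d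
  · exact filt_anti (by omega) (raises_hbar.apply _)
  · exact raises_hbar _ _ (pd_mem_filt a hf)

/-! ### Division by `ħ` -/

@[simp] theorem divHbar_hbar (f : Series 𝕜 p) : divHbar (hbar f) = f := by
  refine Series.ext fun μ => ?_
  simp [coeff, divHbar, hbar]

theorem mem_filt_of_hbar_mem {d : ℕ} {f : Series 𝕜 p} (h : hbar f ∈ filt 𝕜 p (d + 2)) :
    f ∈ filt 𝕜 p d := by
  simpa using divHbar_mem_filt h

/-! ### Monomials -/

variable (𝕜 p) in
open Classical in
/-- The monomial `x^m ħ^k`; it vanishes if an odd coordinate is repeated. -/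
def mon (α : (σ →₀ ℕ) × ℕ) : Series 𝕜 p :=
  ⟨fun μ => if μ = α ∧ Admissible p α.1 then 1 else 0, by
    have key : ∀ μ, (if μ = α ∧ Admissible p α.1 then (1 : 𝕜) else 0) ≠ 0 →
        μ = α ∧ Admissible p α.1 := fun μ h => by
      by_contra h'
      exact h (if_neg h')
    refine ⟨fun μ h => ?_, fun d => (Set.finite_singleton α).subset fun μ h => (key μ h.1).1⟩
    obtain ⟨rfl, h⟩ := key μ h
    exact h⟩

theorem mon_apply_of_admissible {α : (σ →₀ ℕ) × ℕ} (h : Admissible p α.1) (μ) [Decidable (μ = α)] :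
    (mon 𝕜 p α).1 μ = if μ = α then 1 else 0 := by
  simp only [mon, h, and_true]
  congr

theorem mon_eq_zero {α : (σ →₀ ℕ) × ℕ} (h : ¬ Admissible p α.1) : mon 𝕜 p α = 0 := by
  refine Series.ext fun μ => ?_
  simp [coeff, mon, h]

theorem admissible_zero : Admissible p (0 : σ →₀ ℕ) := fun a _ => by simp

theorem mon_zero : mon 𝕜 p 0 = one := by
  classical
  refine Series.ext fun μ => ?_
  simp only [coeff, one]
  rw [mon_apply_of_admissible admissible_zero]

/-- `T` is continuous for the degree-adic topology. -/
def DegContinuous (T : Module.End 𝕜 (Series 𝕜 p)) : Prop :=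
  ∀ d, ∃ e, ∀ f ∈ filt 𝕜 p e, T f ∈ filt 𝕜 p d

theorem Raises.degContinuous {r : ℕ} {T : Module.End 𝕜 (Series 𝕜 p)} (h : Raises r T) :
    DegContinuous T := fun d => ⟨d, fun f hf => filt_anti (by omega) (h d f hf)⟩

theorem DegContinuous.mul {S T : Module.End 𝕜 (Series 𝕜 p)} (hS : DegContinuous S)
    (hT : DegContinuous T) : DegContinuous (S * T) := fun d => by
  obtain ⟨e, he⟩ := hS d
  obtain ⟨e', he'⟩ := hT e
  exact ⟨e', fun f hf => he _ (he' f hf)⟩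

theorem DegContinuous.add {S T : Module.End 𝕜 (Series 𝕜 p)} (hS : DegContinuous S)
    (hT : DegContinuous T) : DegContinuous (S + T) := fun d => by
  obtain ⟨e, he⟩ := hS d
  obtain ⟨e', he'⟩ := hT d
  exact ⟨max e e', fun f hf => add_mem (he f (filt_anti (le_max_left _ _) hf))
    (he' f (filt_anti (le_max_right _ _) hf))⟩

theorem degContinuous_pd (a : σ) : DegContinuous (pd a : Module.End 𝕜 (Series 𝕜 p)) :=
  fun d => ⟨d + 1, fun _ hf => pd_mem_filt a hf⟩

/-- A series has finitely many terms below each degree, so its own monomials approximate it. Keeping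
to these lets hypotheses such as evenness of f reach the monomials. -/
theorem exists_sum_mon (f : Series 𝕜 p) (d : ℕ) : ∃ s : Finset ((σ →₀ ℕ) × ℕ),
    (∀ α ∈ s, f.1 α ≠ 0) ∧ f - ∑ α ∈ s, f.1 α • mon 𝕜 p α ∈ filt 𝕜 p d := by
  classical
  refine ⟨(finite_deg_le f d).toFinset, fun α hα => ?_, fun μ hμ => ?_⟩
  · exact ((Set.Finite.mem_toFinset _).1 hα).1
  · rw [Submodule.coe_sub, Pi.sub_apply, Submodule.coe_sum, Finset.sum_apply,
      sum_congr rfl (g := fun α => if α = μ then f.1 α else 0), sum_ite_eq']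
    · by_cases h : f.1 μ = 0
      · simp [h]
      · rw [if_pos, sub_self]
        simpa using ⟨h, hμ.le⟩
    · intro α hα
      rw [Set.Finite.mem_toFinset] at hα
      rw [Submodule.coe_smul, Pi.smul_apply, mon_apply_of_admissible (f.2.1 α hα.1)]
      simp [eq_comm]

/-- Continuous operators that agree on the monomials of `f` agree on `f`. -/
theorem DegContinuous.eq_of_mon {S T : Module.End 𝕜 (Series 𝕜 p)} (hS : DegContinuous S)
    (hT : DegContinuous T) (f : Series 𝕜 p)
    (h : ∀ α, Admissible p α.1 → f.1 α ≠ 0 → S (mon 𝕜 p α) = T (mon 𝕜 p α)) : S f = T f := by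
  refine eq_of_sub_mem_filt fun d => ?_
  obtain ⟨e, he⟩ := hS d
  obtain ⟨e', he'⟩ := hT d
  obtain ⟨s, hs, hf⟩ := exists_sum_mon f (max e e')
  have h1 := he _ (filt_anti (le_max_left _ _) hf)
  have h2 := he' _ (filt_anti (le_max_right _ _) hf)
  have h3 : S (∑ α ∈ s, f.1 α • mon 𝕜 p α) = T (∑ α ∈ s, f.1 α • mon 𝕜 p α) := by
    simp only [map_sum, map_smul]
    exact sum_congr rfl fun α hα => by rw [h α (f.2.1 α (hs α hα)) (hs α hα)]
  have := sub_mem h1 h2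
  rw [map_sub, map_sub, h3] at this
  simpa using this

/-! ### Multiplication as a bilinear map -/

variable (𝕜 p) in
/-- Multiplication of series as a bilinear map. -/
def mulB : Series 𝕜 p →ₗ[𝕜] Series 𝕜 p →ₗ[𝕜] Series 𝕜 p where
  toFun := lmul
  map_add' f g := by
    refine LinearMap.ext fun h => Subtype.ext <| funext fun μ => ?_
    simp only [lmul, mulFun, Submodule.coe_add, Pi.add_apply, LinearMap.add_apply,
      LinearMap.coe_mk, AddHom.coe_mk]
    split_ifs <;> simp [mul_add, add_mul, sum_add_distrib]
  map_smul' c f := by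
    refine LinearMap.ext fun h => Subtype.ext <| funext fun μ => ?_
    simp only [lmul, mulFun, Submodule.coe_smul, Pi.smul_apply, RingHom.id_apply, smul_eq_mul,
      LinearMap.smul_apply, LinearMap.coe_mk, AddHom.coe_mk]
    split_ifs
    · simp only [mul_sum]
      refine sum_congr rfl fun s _ => sum_congr rfl fun t _ => by ring
    · simp

theorem lmul_add (f g : Series 𝕜 p) : lmul (f + g) = lmul f + lmul g := map_add (mulB 𝕜 p) f g

theorem lmul_sub (f g : Series 𝕜 p) : lmul (f - g) = lmul f - lmul g := map_sub (mulB 𝕜 p) f g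

theorem lmul_smul (c : 𝕜) (f : Series 𝕜 p) : lmul (c • f) = c • lmul f :=
  map_smul (mulB 𝕜 p) c f

@[simp] theorem lmul_zero : lmul (0 : Series 𝕜 p) = 0 := map_zero (mulB 𝕜 p)

/-- Right multiplication by a series. -/
def rmul (g : Series 𝕜 p) : Module.End 𝕜 (Series 𝕜 p) := (mulB 𝕜 p).flip g

theorem rmul_apply (f g : Series 𝕜 p) : rmul g f = lmul f g := rfl

theorem raises_rmul (g : Series 𝕜 p) : Raises 0 (rmul g) := fun d f hf => by
  rw [rmul_apply]
  simpa using lmul_mem_filt hf (mem_filt_zero g)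

/-- No admissibility is needed: if a factor repeats an odd letter, so does the product, and both
sides vanish. -/
theorem lmul_mon_mon (α β : (σ →₀ ℕ) × ℕ) :
    lmul (mon 𝕜 p α) (mon 𝕜 p β) = (koszul p α.1 β.1 : 𝕜) • mon 𝕜 p (α + β) := by
  classical
  by_cases hα : Admissible p α.1
  swap
  · rw [mon_eq_zero hα, mon_eq_zero (α := α + β) fun h => hα (h.of_le (by simp))]
    simp
  by_cases hβ : Admissible p β.1
  swap
  · rw [mon_eq_zero hβ, mon_eq_zero (α := α + β) fun h => hβ (h.of_le (by simp))]
    simp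
  refine Series.ext fun μ => ?_
  have e : coeff μ ((koszul p α.1 β.1 : 𝕜) • mon 𝕜 p (α + β)) =
      (koszul p α.1 β.1 : 𝕜) * (mon 𝕜 p (α + β)).1 μ := rfl
  have e2 : coeff μ (lmul (mon 𝕜 p α) (mon 𝕜 p β)) =
    mulFun p (mon 𝕜 p α).1 (mon 𝕜 p β).1 μ := rfl
  rw [e, e2]
  unfold mulFun
  split_ifs with hμ
  · by_cases h : μ = α + β
    · subst h
      rw [mon_apply_of_admissible hμ, if_pos rfl, mul_one]
      rw [sum_eq_single_of_mem (α.1, β.1) (by simp), sum_eq_single_of_mem (α.2, β.2) (by simp)]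
      · simp [mon_apply_of_admissible hα, mon_apply_of_admissible hβ]
      · rintro ⟨k, l⟩ _ h
        rw [mon_apply_of_admissible hα, mon_apply_of_admissible hβ]
        simp only [Prod.ext_iff, true_and, mul_ite, mul_one, mul_zero] at h ⊢
        split_ifs <;> simp_all
      · rintro ⟨m, n⟩ _ h
        refine sum_eq_zero fun t _ => ?_
        rw [mon_apply_of_admissible hα, mon_apply_of_admissible hβ]
        simp only [Prod.ext_iff, mul_ite, mul_one, mul_zero] at h ⊢
        split_ifs <;> simp_all
    · have h0 : (mon 𝕜 p (α + β)).1 μ = 0 := by simp [mon, h]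
      rw [h0, mul_zero]
      refine sum_eq_zero fun s hs => sum_eq_zero fun t ht => ?_
      rw [HasAntidiagonal.mem_antidiagonal] at hs ht
      rw [mon_apply_of_admissible hα, mon_apply_of_admissible hβ]
      by_cases h1 : (s.1, t.1) = α
      · by_cases h2 : (s.2, t.2) = β
        · exact absurd (by rw [← h1, ← h2]; exact Prod.ext hs.symm ht.symm) h
        · rw [if_neg h2, mul_zero]
      · rw [if_neg h1]; simp
  · by_contra h
    rw [eq_comm, mul_eq_zero, not_or] at h
    exact hμ ((mon 𝕜 p (α + β)).2.1 μ h.2)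

theorem hbar_mon (α : (σ →₀ ℕ) × ℕ) : hbar (mon 𝕜 p α) = mon 𝕜 p (α + (0, 1)) := by
  classical
  refine Series.ext ?_
  rintro ⟨m, k⟩
  rcases α with ⟨n, l⟩
  rcases k with _ | k <;> simp [coeff, hbar, mon]

theorem pd_mon_of_eq_zero {a : σ} {α : (σ →₀ ℕ) × ℕ} (h : α.1 a = 0) :
    pd a (mon 𝕜 p α) = 0 := by
  refine Series.ext fun μ => ?_
  have : (mon 𝕜 p α).1 (μ.1 + Finsupp.single a 1, μ.2) = 0 := by
    simp only [mon, ite_eq_right_iff, one_ne_zero, imp_false, not_and]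
    rintro rfl
    simp at h
  simp [coeff, pd, this]

theorem pd_mon_add_single (a : σ) (α : (σ →₀ ℕ) × ℕ)
    (h : Admissible p (α.1 + Finsupp.single a 1)) :
    pd a (mon 𝕜 p (α + (Finsupp.single a 1, 0))) =
      (((α.1 a : 𝕜) + 1) * (koszul p (Finsupp.single a 1) α.1 : 𝕜)) • mon 𝕜 p α := by
  classical
  refine Series.ext fun μ => ?_
  have e : ((μ.1 + Finsupp.single a 1, μ.2) = α + (Finsupp.single a 1, 0)) ↔ μ = α := by
    simp [Prod.ext_iff]
  have h1 : (mon 𝕜 p (α + (Finsupp.single a 1, 0))).1 (μ.1 + Finsupp.single a 1, μ.2) =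
      if μ = α then 1 else 0 := by
    rw [mon_apply_of_admissible (by simpa using h)]
    exact if_congr e rfl rfl
  have h2 : (mon 𝕜 p α).1 μ = if μ = α then 1 else 0 :=
    mon_apply_of_admissible (h.of_le (by simp)) μ
  have e1 : coeff μ (pd a (mon 𝕜 p (α + (Finsupp.single a 1, 0)))) =
    ((μ.1 a : 𝕜) + 1) * (koszul p (Finsupp.single a 1) μ.1 : 𝕜) *
      (mon 𝕜 p (α + (Finsupp.single a 1, 0))).1 (μ.1 + Finsupp.single a 1, μ.2) := rfl
  have e2 : coeff μ ((((α.1 a : 𝕜) + 1) * (koszul p (Finsupp.single a 1) α.1 : 𝕜)) •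
    mon 𝕜 p α) = ((α.1 a : 𝕜) + 1) * (koszul p (Finsupp.single a 1) α.1 : 𝕜) *
      (mon 𝕜 p α).1 μ := rfl
  rw [e1, e2, h1, h2]
  split_ifs with h3
  · rw [h3]
  · simp

theorem hbar_lmul (f g : Series 𝕜 p) : hbar (lmul f g) = lmul f (hbar g) := by
  have h1 : ((hbar : Module.End 𝕜 (Series 𝕜 p)) * rmul g) f = (rmul (hbar g)) f := by
    refine (raises_hbar.mul (raises_rmul g)).degContinuous.eq_of_mon
      (raises_rmul _).degContinuous f fun α hα _ => ?_
    have h2 : ((hbar : Module.End 𝕜 (Series 𝕜 p)) * lmul (mon 𝕜 p α)) g = (lmul (mon 𝕜 p α) * (hbar : Module.End 𝕜 (Series 𝕜 p))) g := by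
      refine (raises_hbar.mul (raises_lmul (mem_filt_zero _))).degContinuous.eq_of_mon
        ((raises_lmul (mem_filt_zero _)).mul raises_hbar).degContinuous g fun β hβ _ => ?_
      simp only [Module.End.mul_apply, lmul_mon_mon, map_smul, hbar_mon]
      simp [add_assoc]
    exact h2
  exact h1

theorem hbar_pd (a : σ) (f : Series 𝕜 p) : hbar (pd a f) = pd a (hbar f) := by
  refine Series.ext ?_
  rintro ⟨m, k⟩
  rcases k with _ | k <;> simp [coeff, hbar, pd]

theorem one_lmul (f : Series 𝕜 p) : lmul one f = f := by
  have h : lmul one f = (1 : Module.End 𝕜 (Series 𝕜 p)) f := by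
    refine (raises_lmul (mem_filt_zero _)).degContinuous.eq_of_mon
      Raises.one.degContinuous f fun α hα _ => ?_
    rw [← mon_zero, lmul_mon_mon]
    simp
  exact h

theorem lmul_one (f : Series 𝕜 p) : lmul f one = f := by
  have h : rmul one f = (1 : Module.End 𝕜 (Series 𝕜 p)) f := by
    refine (raises_rmul one).degContinuous.eq_of_mon
      Raises.one.degContinuous f fun α hα _ => ?_
    rw [rmul_apply, ← mon_zero, lmul_mon_mon]
    simp
  exact h

theorem pd_one (a : σ) : pd a (one : Series 𝕜 p) = 0 := by
  rw [← mon_zero]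
  exact pd_mon_of_eq_zero (by simp)

/-- All terms of `f` have parity `α`. -/
def IsHomog (α : ZMod 2) (f : Series 𝕜 p) : Prop := ∀ μ, f.1 μ ≠ 0 → monParity p μ.1 = α

/-- Both sides are continuous in each argument, so F, f and g may be taken to be monomials, and the
identity becomes an equality of signs. It expresses that multiplication by an even series commutes
with every left multiplication, which is what conjugation uses. -/
theorem lmul_lmul_comm {F : Series 𝕜 p} (hF : IsHomog 0 F) (f g : Series 𝕜 p) :
    lmul F (lmul f g) = lmul f (lmul F g) := by
  have h1 : (rmul (lmul f g)) F = (lmul f * rmul g) F := by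
    refine (raises_rmul _).degContinuous.eq_of_mon ((raises_lmul
      (mem_filt_zero _)).mul (raises_rmul _)).degContinuous F fun α hα hα' => ?_
    have h2 : (lmul (mon 𝕜 p α) * rmul g) f =
        (rmul (lmul (mon 𝕜 p α) g)) f := by
      refine ((raises_lmul (mem_filt_zero _)).mul (raises_rmul _)).degContinuous.eq_of_mon
        (raises_rmul _).degContinuous f fun β hβ _ => ?_
      have h3 : (lmul (mon 𝕜 p α) * lmul (mon 𝕜 p β)) g =
          (lmul (mon 𝕜 p β) * lmul (mon 𝕜 p α)) g := by
        refine ((raises_lmul (mem_filt_zero _)).mul (raises_lmul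
          (mem_filt_zero _))).degContinuous.eq_of_mon ((raises_lmul (mem_filt_zero _)).mul
          (raises_lmul (mem_filt_zero _))).degContinuous g fun γ hγ _ => ?_
        simp only [Module.End.mul_apply, lmul_mon_mon, map_smul, smul_smul]
        rw [add_left_comm]
        -- A repeated odd letter kills both sides; otherwise α and β share no odd letter and the
        -- even α commutes with β.
        by_cases h : Admissible p (β + (α + γ)).1
        · congr 1
          simp only [Prod.fst_add, koszul_add_right]
          have := koszul_comm_of_even (p := p) (m := α.1) (n := β.1) (hF α hα') ?_
          · rw [this]; push_cast; ring
          · intro b hb h0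
            have := h b hb
            simp only [Prod.fst_add, Finsupp.add_apply] at this
            omega
        · rw [mon_eq_zero h, smul_zero, smul_zero]
      exact h3
    exact h2
  exact h1

theorem exists_eq_add_single {α : (σ →₀ ℕ) × ℕ} {a : σ} (h : α.1 a ≠ 0) :
    ∃ β : (σ →₀ ℕ) × ℕ, α = β + (Finsupp.single a 1, 0) := by
  refine ⟨(α.1 - Finsupp.single a 1, α.2), Prod.ext ?_ (by simp)⟩
  simp only [Prod.mk_add_mk]
  rw [tsub_add_cancel_of_le]
  rw [Finsupp.single_le_iff]
  omega

end

section

variable {𝕜 : Type*} [Field 𝕜] {σ : Type*} [LinearOrder σ] {p : σ → ZMod 2}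

/-! ### The Leibniz rule -/

theorem koszul_single_left_of_even {a : σ} (h : p a ≠ 1) (m : σ →₀ ℕ) (n : ℕ) :
    koszul p (Finsupp.single a n) m = 1 := by
  simp [koszul, h]

theorem koszul_single_right_of_even {a : σ} (h : p a ≠ 1) (m : σ →₀ ℕ) (n : ℕ) :
    koszul p m (Finsupp.single a n) = 1 := by
  simp [koszul, h]

theorem exists_of_not_admissible {m : σ →₀ ℕ} (h : ¬ Admissible p m) : ∃ b, p b = 1 ∧ 1 < m b := by
  simpa [Admissible] using h

theorem not_admissible {m : σ →₀ ℕ} {b : σ} (hb : p b = 1) (h : 1 < m b) : ¬ Admissible p m :=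
  fun h' => absurd (h' b hb) (by omega)

/-- The cases are whether x^a occurs in each factor. The delicate one is an odd x^a in both: the
product is zero, and the two terms on the right cancel because the even first factor becomes odd
once x^a is removed. -/
theorem pd_lmul_mon (a : σ) {α β : (σ →₀ ℕ) × ℕ} (hα : Admissible p α.1) (hβ : Admissible p β.1)
    (hev : monParity p α.1 = 0) :
    pd a (lmul (mon 𝕜 p α) (mon 𝕜 p β)) =
      lmul (pd a (mon 𝕜 p α)) (mon 𝕜 p β) + lmul (mon 𝕜 p α) (pd a (mon 𝕜 p β)) := by
  rw [lmul_mon_mon, map_smul]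
  by_cases ha : α.1 a = 0
  · rw [pd_mon_of_eq_zero ha]
    by_cases hb : β.1 a = 0
    · rw [pd_mon_of_eq_zero hb, pd_mon_of_eq_zero (by simp [ha, hb])]
      simp
    · obtain ⟨β, rfl⟩ := exists_eq_add_single hb
      rw [← add_assoc, pd_mon_add_single a β hβ, map_smul, lmul_mon_mon, lmul_zero,
        LinearMap.zero_apply, zero_add]
      by_cases h : Admissible p ((α + β).1 + Finsupp.single a 1)
      · rw [pd_mon_add_single a _ h, smul_smul, smul_smul]
        congr 1
        simp only [Prod.fst_add, Finsupp.add_apply, ha, koszul_add_right]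
        rw [koszul_single_comm_of_even (fun _ => ha) hev]
        have := koszul_cast_mul_self (𝕜 := 𝕜) (p := p) (Finsupp.single a 1) α.1
        push_cast
        linear_combination (koszul p α.1 β.1 * (0 + (β.1 a : 𝕜) + 1) *
          koszul p (Finsupp.single a 1) β.1) * this
      -- A repeated odd letter b must differ from a here, so it survives ∂_a and both sides are
      -- zero.
      · obtain ⟨b, hb1, hb2⟩ := exists_of_not_admissible h
        have hβb := hβ b hb1
        simp only [Prod.fst_add, Finsupp.add_apply] at hb2 hβb
        have hab : a ≠ b := by
          rintro rfl
          omega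
        rw [mon_eq_zero (α := α + β + _) (by simpa using h), mon_eq_zero (α := α + β)
          (not_admissible hb1 (by simpa [Finsupp.single_apply, hab] using hb2))]
        simp
  · obtain ⟨α, rfl⟩ := exists_eq_add_single ha
    rw [pd_mon_add_single a α hα, lmul_smul, LinearMap.smul_apply, lmul_mon_mon]
    by_cases hb : β.1 a = 0
    · rw [pd_mon_of_eq_zero hb, map_zero, add_zero, add_right_comm]
      by_cases h : Admissible p ((α + β).1 + Finsupp.single a 1)
      · rw [pd_mon_add_single a _ h, smul_smul, smul_smul]
        congr 1
        simp only [Prod.fst_add, Finsupp.add_apply, hb, koszul_add_right, koszul_add_left]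
        have := koszul_cast_mul_self (𝕜 := 𝕜) (p := p) (Finsupp.single a 1) β.1
        push_cast
        linear_combination (koszul p α.1 β.1 * ((α.1 a : 𝕜) + 1) *
          koszul p (Finsupp.single a 1) α.1) * this
      · obtain ⟨b, hb1, hb2⟩ := exists_of_not_admissible h
        have hαb := hα b hb1
        simp only [Prod.fst_add, Finsupp.add_apply] at hb2 hαb
        have hab : a ≠ b := by
          rintro rfl
          omega
        rw [mon_eq_zero (α := α + β + _) (by simpa using h), mon_eq_zero (α := α + β)
          (not_admissible hb1 (by simpa [Finsupp.single_apply, hab] using hb2))]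
        simp
    · obtain ⟨β, rfl⟩ := exists_eq_add_single hb
      rw [pd_mon_add_single a β hβ, map_smul, lmul_mon_mon]
      by_cases hp : p a = 1
      · have h1 := hα a hp
        have h2 := hβ a hp
        simp only [Prod.fst_add, Finsupp.add_apply, Finsupp.single_eq_same] at h1 h2
        have h3 : α.1 a = 0 := by omega
        have h4 : β.1 a = 0 := by omega
        have h5 : monParity p α.1 = 1 := by
          simp only [Prod.fst_add, monParity_add, monParity_single, hp] at hev
          rcases zmod_two_cases (monParity p α.1) with h | h
          · simp [h] at hev
          · exact h
        have h6 := koszul_single_comm (p := p) (b := a) (m := α.1) (fun _ => h3)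
        rw [h5, hp] at h6
        have h7 : (koszul p α.1 (Finsupp.single a 1) : 𝕜) *
            (koszul p (Finsupp.single a 1) α.1 : 𝕜) = -1 := by
          rw [← Int.cast_mul, h6]
          simp [parSign]
        rw [mon_eq_zero (α := α + _ + (β + _)) (not_admissible hp (by simp; omega)), map_zero,
          smul_zero, add_right_comm α, ← add_assoc α, smul_smul, smul_smul, ← add_smul]
        rw [eq_comm]
        convert zero_smul 𝕜 _
        simp only [Prod.fst_add, koszul_add_right, koszul_add_left, h3, h4]
        push_cast
        have := koszul_cast_mul_self (𝕜 := 𝕜) (p := p) (Finsupp.single a 1) β.1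
        linear_combination (koszul p α.1 β.1 : 𝕜) * h7 + (koszul p α.1 β.1 : 𝕜) * this
      · simp only [Prod.fst_add, koszul_add_right, koszul_add_left,
          koszul_single_left_of_even hp, koszul_single_right_of_even hp]
        rw [← add_assoc (α + (Finsupp.single a 1, 0)), ← add_assoc α,
          add_right_comm α (Finsupp.single a 1, 0) β]
        by_cases h : Admissible p ((α + β + (Finsupp.single a 1, 0)).1 + Finsupp.single a 1)
        · rw [pd_mon_add_single a _ h, smul_smul, smul_smul, smul_smul, ← add_smul]
          congr 1
          simp only [Prod.fst_add, koszul_single_left_of_even hp,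
            Finsupp.add_apply, Finsupp.single_eq_same]
          push_cast
          ring
        · obtain ⟨b, hb1, hb2⟩ := exists_of_not_admissible h
          have hab : a ≠ b := by
            rintro rfl
            exact hp hb1
          have hb3 : 1 < (α + β + (Finsupp.single a 1, 0)).1 b := by
            simpa [Finsupp.single_apply, hab] using hb2
          rw [mon_eq_zero (α := α + β + (Finsupp.single a 1, 0) + (Finsupp.single a 1, 0))
              (by simpa using h),
            mon_eq_zero (α := α + β + (Finsupp.single a 1, 0)) (not_admissible hb1 hb3)]
          simp

theorem pd_lmul (a : σ) {F : Series 𝕜 p} (hF : IsHomog 0 F) (g : Series 𝕜 p) :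
    pd a (lmul F g) = lmul (pd a F) g + lmul F (pd a g) := by
  have h1 : ((pd a : Module.End 𝕜 (Series 𝕜 p)) * rmul g) F =
      (rmul g * (pd a : Module.End 𝕜 (Series 𝕜 p)) + rmul (pd a g)) F := by
    refine ((degContinuous_pd a).mul (raises_rmul g).degContinuous).eq_of_mon
      (((raises_rmul g).degContinuous.mul (degContinuous_pd a)).add
        (raises_rmul _).degContinuous) F fun α hα hα' => ?_
    have h2 : ((pd a : Module.End 𝕜 (Series 𝕜 p)) * lmul (mon 𝕜 p α)) g =
        (lmul (pd a (mon 𝕜 p α)) + lmul (mon 𝕜 p α) * (pd a : Module.End 𝕜 (Series 𝕜 p))) g := by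
      refine ((degContinuous_pd a).mul
        (raises_lmul (mem_filt_zero _)).degContinuous).eq_of_mon
        ((raises_lmul (mem_filt_zero _)).degContinuous.add
        ((raises_lmul (mem_filt_zero _)).degContinuous.mul (degContinuous_pd a))) g
        fun β hβ _ => ?_
      exact pd_lmul_mon a hα hβ (hF α hα')
    exact h2
  exact h1

/-! ### Parity -/

theorem parityOp_apply (f : Series 𝕜 p) (μ) :
    (parityOp f).1 μ = (parSign (monParity p μ.1) : 𝕜) * f.1 μ := by
  simp only [parityOp, parSign, LinearMap.coe_mk, AddHom.coe_mk]
  split_ifs <;> simp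

theorem IsHomog.parityOp {α : ZMod 2} {f : Series 𝕜 p} (h : IsHomog α f) :
    parityOp f = (parSign α : 𝕜) • f := by
  refine Series.ext fun μ => ?_
  by_cases h0 : f.1 μ = 0
  · simp [coeff, parityOp_apply, h0]
  · have e : coeff μ ((parSign α : 𝕜) • f) = (parSign α : 𝕜) * f.1 μ := rfl
    rw [e, ← h μ h0]
    exact parityOp_apply f μ

theorem IsHomog.add {α : ZMod 2} {f g : Series 𝕜 p} (hf : IsHomog α f) (hg : IsHomog α g) :
    IsHomog α (f + g) := by
  intro μ h
  by_cases h0 : f.1 μ = 0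
  · exact hg μ fun h1 => h (by simp [h0, h1])
  · exact hf μ h0

theorem isHomog_one : IsHomog 0 (one : Series 𝕜 p) := by
  intro μ h
  have : μ = 0 := by
    by_contra h'
    exact h (if_neg h')
  simp [this]

theorem IsHomog.hbar {α : ZMod 2} {f : Series 𝕜 p} (hf : IsHomog α f) : IsHomog α (hbar f) := by
  intro μ h
  simp only [SuperAiry.hbar, LinearMap.coe_mk, AddHom.coe_mk] at h
  split_ifs at h with h0
  · exact absurd rfl h
  · exact hf (μ.1, μ.2 - 1) h

theorem IsHomog.pd {α : ZMod 2} {f : Series 𝕜 p} (hf : IsHomog α f) (a : σ) :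
    IsHomog (α + p a) (pd a f) := by
  intro μ h
  have := hf _ (right_ne_zero_of_mul h)
  rw [monParity_add, monParity_single] at this
  rw [← this]
  rcases zmod_two_cases (p a) with h | h <;> simp [h, add_assoc, CharTwo.add_self_eq_zero]

theorem IsHomog.lmul {α β : ZMod 2} {f g : Series 𝕜 p} (hf : IsHomog α f) (hg : IsHomog β g) :
    IsHomog (α + β) (lmul f g) := by
  intro μ h
  obtain ⟨-, μ, ν, rfl, h1, h2⟩ := mulFun_ne_zero h
  rw [← hf μ h1, ← hg ν h2]
  exact monParity_add _ _

/-- `T` is homogeneous of parity `α`. -/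
def ParityShift (α : ZMod 2) (T : Module.End 𝕜 (Series 𝕜 p)) : Prop :=
  ∀ β f, IsHomog β f → IsHomog (α + β) (T f)

theorem parSign_sq (α : ZMod 2) : (parSign α : 𝕜) * parSign α = 1 := by
  unfold parSign
  split_ifs <;> simp

theorem parSign_add (α β : ZMod 2) : parSign (α + β) = parSign α * parSign β := by
  revert α β
  unfold parSign
  decide

/-- On homogeneous series this is a comparison of signs; a general series is the sum of its even and
odd parts, (f ± Pf)/2 with P the parity involution. -/
theorem ParityShift.conj [CharZero 𝕜] {α : ZMod 2} {T : Module.End 𝕜 (Series 𝕜 p)}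
    (hT : ParityShift α T) : parityOp * T * parityOp = (parSign α : 𝕜) • T := by
  have key : ∀ β f, IsHomog β f → parityOp (T (parityOp f)) = (parSign α : 𝕜) • T f := by
    intro β f hf
    rw [hf.parityOp, map_smul, map_smul, (hT β f hf).parityOp, smul_smul, parSign_add]
    congr 1
    push_cast
    linear_combination (parSign α : 𝕜) * parSign_sq (𝕜 := 𝕜) β
  refine LinearMap.ext fun f => ?_
  have hs : ∀ β : ZMod 2, IsHomog β (f + (parSign β : 𝕜) • parityOp f) := by
    intro β μ h
    by_contra h'
    refine h ?_
    have e : (f + (parSign β : 𝕜) • parityOp f).1 μ =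
      f.1 μ + (parSign β : 𝕜) * (parityOp f).1 μ := rfl
    rw [e, parityOp_apply]
    rcases zmod_two_cases β with hb | hb <;>
      rcases zmod_two_cases (monParity p μ.1) with hm | hm <;> simp_all [parSign]
  have e : f = (2⁻¹ : 𝕜) • ((f + (parSign 0 : 𝕜) • parityOp f) +
      (f + (parSign 1 : 𝕜) • parityOp f)) := by
    have : (f + (parSign 0 : 𝕜) • parityOp f) + (f + (parSign 1 : 𝕜) • parityOp f) =
        (2 : 𝕜) • f := by
      simp only [parSign, if_true, one_ne_zero, if_false, Int.cast_one, Int.cast_neg]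
      module
    rw [this, smul_smul, inv_mul_cancel₀ two_ne_zero, one_smul]
  have h0 := key 0 _ (hs 0)
  have h1 := key 1 _ (hs 1)
  change parityOp (T (parityOp f)) = (parSign α : 𝕜) • T f
  generalize f + (parSign 0 : 𝕜) • parityOp f = f₀ at *
  generalize f + (parSign 1 : 𝕜) • parityOp f = f₁ at *
  subst e
  rw [map_smul parityOp, map_smul T, map_smul parityOp, map_add parityOp, map_add T,
    map_add parityOp, h0, h1, map_smul T, map_add T]
  module

theorem superComm_of_parityShift [CharZero 𝕜] {α β : ZMod 2} {S T : Module.End 𝕜 (Series 𝕜 p)}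
    (hS : ParityShift α S) (hT : ParityShift β T) :
    superComm S T = S * T - (parSign (α * β) : 𝕜) • (T * S) := by
  have hS' : ∀ f, parityOp (S (parityOp f)) = (parSign α : 𝕜) • S f :=
    fun f => LinearMap.congr_fun hS.conj f
  have hT' : ∀ f, parityOp (T (parityOp f)) = (parSign β : 𝕜) • T f :=
    fun f => LinearMap.congr_fun hT.conj f
  refine LinearMap.ext fun f => ?_
  change S (T f) - ((2⁻¹ : 𝕜) • (T (S f) + parityOp (T (parityOp (S f)))) +
    (2⁻¹ : 𝕜) • (T (parityOp (S (parityOp f))) -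
      parityOp (T (parityOp (parityOp (S (parityOp f))))))) =
    S (T f) - (parSign (α * β) : 𝕜) • T (S f)
  rw [hT', hT', hS', map_smul T]
  congr 1
  rcases zmod_two_cases β with hb | hb
  · have h4 : (parSign 0 : 𝕜) = 1 := by simp [parSign]
    rw [hb, mul_zero, h4]
    module
  · have h4 : (parSign 1 : 𝕜) = -1 := by simp [parSign]
    rw [hb, mul_one, h4]
    module

/-- An even operator is fixed by parity conjugation, so the two halves of T recombine, whether or
not T is homogeneous. -/
theorem superComm_lmul_of_even [CharZero 𝕜] {F : Series 𝕜 p} (hF : IsHomog 0 F)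
    (T : Module.End 𝕜 (Series 𝕜 p)) : superComm (lmul F) T = lmul F * T - T * lmul F := by
  have h : parityOp * lmul F * parityOp = lmul F := by
    have hs : ParityShift 0 (lmul F) := fun β f hf => hF.lmul hf
    rw [hs.conj]
    simp [parSign]
  refine LinearMap.ext fun f => ?_
  have h' : parityOp (lmul F (parityOp f)) = lmul F f := LinearMap.congr_fun h f
  change lmul F (T f) - ((2⁻¹ : 𝕜) • (T (lmul F f) + parityOp (T (parityOp (lmul F f)))) +
    (2⁻¹ : 𝕜) • (T (parityOp (lmul F (parityOp f))) -
      parityOp (T (parityOp (parityOp (lmul F (parityOp f))))))) = lmul F (T f) - T (lmul F f)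
  rw [h']
  module

end

section

variable {𝕜 : Type*} [Field 𝕜] {σ : Type*} [LinearOrder σ] {p : σ → ZMod 2}

/-! ### Conjugation by `exp (F / ħ)` -/

/-- `∑ tⁿ eₙ` is the flow of `T` under the derivation `-(1/ħ) [F, ·]`. -/
structure IsFlow (F : Series 𝕜 p) (T : Module.End 𝕜 (Series 𝕜 p))
    (e : ℕ → Module.End 𝕜 (Series 𝕜 p)) : Prop where
  zero : e 0 = T
  step : ∀ n f, hbar (((n + 1 : ℕ) : 𝕜) • e (n + 1) f) = e n (lmul F f) - lmul F (e n f)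
  comm : ∀ n f, hbar (e n f) = e n (hbar f)
  raises : ∀ n, Raises n (e n)

/-- `T'` is the conjugate of `T` by `exp (F / ħ)`. -/
def Conj (F : Series 𝕜 p) (T T' : Module.End 𝕜 (Series 𝕜 p)) : Prop :=
  ∃ e, IsFlow F T e ∧ ∀ N f, T' f - ∑ n ∈ range N, e n f ∈ filt 𝕜 p N

/-- The operators `S a` tend pointwise to `T` along `l`. -/
def TendstoPt {α : Type*} (l : Filter α) (S : α → Module.End 𝕜 (Series 𝕜 p))
    (T : Module.End 𝕜 (Series 𝕜 p)) : Prop :=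
  ∀ f d, ∀ᶠ a in l, S a f - T f ∈ filt 𝕜 p d

/-- The derivation `-(1/ħ) [F, ·]`. -/
def adDiv (F : Series 𝕜 p) (T : Module.End 𝕜 (Series 𝕜 p)) : Module.End 𝕜 (Series 𝕜 p) :=
  divHbar * (T * lmul F - lmul F * T)

theorem adDiv_apply (F : Series 𝕜 p) (T : Module.End 𝕜 (Series 𝕜 p)) (f : Series 𝕜 p) :
    adDiv F T f = divHbar (T (lmul F f) - lmul F (T f)) := rfl

/-- Multiplication by ħ has the left inverse `divHbar`, so the recursion leaves no freedom: the
flow, and with it the conjugate, is determined by T. -/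
theorem IsFlow.eq_iterate [CharZero 𝕜] {F : Series 𝕜 p} {T : Module.End 𝕜 (Series 𝕜 p)}
    {e : ℕ → Module.End 𝕜 (Series 𝕜 p)} (h : IsFlow F T e) (n : ℕ) (f : Series 𝕜 p) :
    (n.factorial : 𝕜) • e n f = (adDiv F)^[n] T f := by
  induction n generalizing f with
  | zero => simp [h.zero]
  | succ n ih =>
    have h1 : (n.factorial : 𝕜) • e n (lmul F f) - (n.factorial : 𝕜) • lmul F (e n f) =
        (n.factorial : 𝕜) • (e n (lmul F f) - lmul F (e n f)) := (smul_sub _ _ _).symm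
    rw [Function.iterate_succ_apply', adDiv_apply, ← ih, ← ih, map_smul (lmul F)]
    refine Eq.trans ?_ (congrArg divHbar h1.symm)
    rw [← h.step, map_smul, divHbar_hbar, smul_smul, Nat.factorial_succ]
    push_cast
    rw [mul_comm]

theorem IsFlow.eq_inv_smul [CharZero 𝕜] {F : Series 𝕜 p} {T : Module.End 𝕜 (Series 𝕜 p)}
    {e : ℕ → Module.End 𝕜 (Series 𝕜 p)} (h : IsFlow F T e) (n : ℕ) (f : Series 𝕜 p) :
    e n f = (n.factorial : 𝕜)⁻¹ • (adDiv F)^[n] T f := by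
  rw [← h.eq_iterate, smul_smul, inv_mul_cancel₀, one_smul]
  exact_mod_cast n.factorial_ne_zero

theorem Conj.unique [CharZero 𝕜] {F : Series 𝕜 p} {T T₁ T₂ : Module.End 𝕜 (Series 𝕜 p)}
    (h₁ : Conj F T T₁) (h₂ : Conj F T T₂) : T₁ = T₂ := by
  obtain ⟨e₁, he₁, hT₁⟩ := h₁
  obtain ⟨e₂, he₂, hT₂⟩ := h₂
  refine LinearMap.ext fun f => eq_of_sub_mem_filt fun d => ?_
  have := sub_mem (hT₁ d f) (hT₂ d f)
  simp only [he₁.eq_inv_smul, he₂.eq_inv_smul] at this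
  simpa using this

theorem conj_zero (F : Series 𝕜 p) : Conj F 0 0 :=
  ⟨fun _ => 0, ⟨rfl, by simp, by simp, fun _ => Raises.zero⟩, by simp⟩

theorem Conj.add {F : Series 𝕜 p} {S S' T T' : Module.End 𝕜 (Series 𝕜 p)} (hS : Conj F S S')
    (hT : Conj F T T') : Conj F (S + T) (S' + T') := by
  obtain ⟨e, he, hS⟩ := hS
  obtain ⟨e', he', hT⟩ := hT
  refine ⟨fun n => e n + e' n, ⟨by rw [he.zero, he'.zero], fun n f => ?_, fun n f => ?_,
    fun n => (he.raises n).add (he'.raises n)⟩, fun N f => ?_⟩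
  · simp only [LinearMap.add_apply, smul_add, map_add, he.step, he'.step]
    abel
  · simp only [LinearMap.add_apply, map_add, he.comm, he'.comm]
  · simp only [LinearMap.add_apply, sum_add_distrib]
    convert add_mem (hS N f) (hT N f) using 1
    abel

theorem Conj.smul {F : Series 𝕜 p} {T T' : Module.End 𝕜 (Series 𝕜 p)} (c : 𝕜)
    (hT : Conj F T T') : Conj F (c • T) (c • T') := by
  obtain ⟨e, he, hT⟩ := hT
  refine ⟨fun n => c • e n, ⟨by rw [he.zero], fun n f => ?_, fun n f => ?_,
    fun n => (he.raises n).smul c⟩, fun N f => ?_⟩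
  · simp only [LinearMap.smul_apply, map_smul, ← smul_sub, ← he.step]
    rw [smul_comm]
  · simp only [LinearMap.smul_apply, map_smul, he.comm]
  · simp only [LinearMap.smul_apply, ← smul_sum, ← smul_sub]
    exact Submodule.smul_mem _ _ (hT N f)

theorem Conj.sub {F : Series 𝕜 p} {S S' T T' : Module.End 𝕜 (Series 𝕜 p)} (hS : Conj F S S')
    (hT : Conj F T T') : Conj F (S - T) (S' - T') := by
  have := hS.add (hT.smul (-1))
  have e : ∀ A B : Module.End 𝕜 (Series 𝕜 p), A + (-1 : 𝕜) • B = A - B := fun A B =>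
    LinearMap.ext fun f => by
      change A f + (-1 : 𝕜) • B f = A f - B f
      module
  rwa [e, e] at this

theorem Conj.sum {α : Type*} {F : Series 𝕜 p} (s : Finset α)
    {T T' : α → Module.End 𝕜 (Series 𝕜 p)} (h : ∀ a ∈ s, Conj F (T a) (T' a)) :
    Conj F (∑ a ∈ s, T a) (∑ a ∈ s, T' a) := by
  classical
  induction s using Finset.induction_on with
  | empty => exact conj_zero F
  | insert a s ha ih =>
    rw [sum_insert ha, sum_insert ha]
    exact (h a (mem_insert_self _ _)).add (ih fun b hb => h b (mem_insert_of_mem hb))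

/-- The Cauchy product of the two flows is a flow, because a commutator with F is a derivation and
the factor ħ can be moved through the terms of the first flow. -/
theorem Conj.mul {F : Series 𝕜 p} {S S' T T' : Module.End 𝕜 (Series 𝕜 p)} (hS : Conj F S S')
    (hT : Conj F T T') : Conj F (S * T) (S' * T') := by
  obtain ⟨e, he, hS⟩ := hS
  obtain ⟨e', he', hT⟩ := hT
  refine ⟨fun n => ∑ k ∈ HasAntidiagonal.antidiagonal n, e k.1 * e' k.2,
    ⟨by simp [he.zero, he'.zero], fun n f => ?_, fun n f => ?_, fun n => ?_⟩, fun N f => ?_⟩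
  · simp only [LinearMap.sum_apply, Module.End.mul_apply, map_sum]
    -- The factor n + 1 = k + l is split over the two indices, which separates the two halves of the
    -- Leibniz rule.
    have key : ∀ g : ℕ × ℕ → Series 𝕜 p, ((n + 1 : ℕ) : 𝕜) •
        ∑ k ∈ HasAntidiagonal.antidiagonal (n + 1), g k =
        ∑ k ∈ HasAntidiagonal.antidiagonal n, ((k.1 + 1 : ℕ) : 𝕜) • g (k.1 + 1, k.2) +
        ∑ k ∈ HasAntidiagonal.antidiagonal n, ((k.2 + 1 : ℕ) : 𝕜) • g (k.1, k.2 + 1) := by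
      intro g
      have h1 := Finset.Nat.sum_antidiagonal_succ (n := n)
        (f := fun k : ℕ × ℕ => (k.1 : 𝕜) • g k)
      have h2 := Finset.Nat.sum_antidiagonal_succ' (n := n)
        (f := fun k : ℕ × ℕ => (k.2 : 𝕜) • g k)
      simp only [Nat.cast_zero, zero_smul, zero_add] at h1 h2
      rw [← h1, ← h2, ← sum_add_distrib, smul_sum]
      refine sum_congr rfl fun k hk => ?_
      rw [← add_smul, ← Nat.cast_add, HasAntidiagonal.mem_antidiagonal.1 hk]
    rw [key, map_add, map_sum, map_sum, ← sum_add_distrib, ← sum_sub_distrib]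
    refine sum_congr rfl fun k _ => ?_
    have h1 := he.step k.1 (e' k.2 f)
    have h2 := congrArg (e k.1) (he'.step k.2 f)
    rw [h1, ← map_smul (e k.1), he.comm, h2, map_sub]
    abel
  · simp only [LinearMap.sum_apply, Module.End.mul_apply, map_sum, he.comm, he'.comm]
  · refine Raises.sum fun k hk => ?_
    rw [← HasAntidiagonal.mem_antidiagonal.1 hk]
    exact (he.raises _).mul (he'.raises _)
  · simp only [LinearMap.sum_apply, Module.End.mul_apply]
    -- In the triangular sum the second flow is cut at N - k; the error starts in degree N - k and e
    -- k raises it back to N.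
    have h1 : ∑ n ∈ range N, ∑ k ∈ HasAntidiagonal.antidiagonal n, e k.1 (e' k.2 f) =
        ∑ k ∈ range N, e k (∑ l ∈ range (N - k), e' l f) := by
      simp only [Finset.Nat.sum_antidiagonal_eq_sum_range_succ_mk, map_sum]
      exact Finset.sum_range_diag_flip N fun k l => e k (e' l f)
    rw [h1, ← sub_add_sub_cancel _ (∑ k ∈ range N, e k (T' f)), ← sum_sub_distrib]
    refine add_mem (hS N _) (sum_mem fun k hk => ?_)
    rw [← map_sub]
    have := he.raises k _ _ (hT (N - k) f)
    rwa [Nat.sub_add_cancel (mem_range.1 hk).le] at this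

/-- A flow that stops after one step. -/
theorem conj_of_step {F : Series 𝕜 p} {T T₁ : Module.End 𝕜 (Series 𝕜 p)}
    (h₁ : ∀ f, hbar (T₁ f) = T (lmul F f) - lmul F (T f))
    (h₂ : ∀ f, T₁ (lmul F f) = lmul F (T₁ f)) (h₃ : ∀ f, hbar (T f) = T (hbar f))
    (h₄ : ∀ f, hbar (T₁ f) = T₁ (hbar f)) (h₅ : Raises 0 T) (h₆ : Raises 1 T₁) :
    Conj F T (T + T₁) := by
  refine ⟨fun n => if n = 0 then T else if n = 1 then T₁ else 0,
    ⟨rfl, fun n f => ?_, fun n f => ?_, fun n => ?_⟩, fun N f => ?_⟩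
  · rcases n with _ | _ | n
    · simp [← h₁]
    · simp [h₂]
    · simp
  · rcases n with _ | _ | n
    · simp [h₃]
    · simp [h₄]
    · simp
  · rcases n with _ | _ | n
    · exact h₅
    · exact h₆
    · exact Raises.zero
  · rcases N with _ | _ | N
    · simp
    · simpa using h₆.apply f
    · rw [sum_range_succ', sum_range_succ']
      simp [add_comm (T₁ f)]

theorem conj_lmul {F : Series 𝕜 p} (hF : IsHomog 0 F) (c : Series 𝕜 p) :
    Conj F (lmul c) (lmul c) := by
  have := conj_of_step (F := F) (T := lmul c) (T₁ := 0) (fun f => ?_) (fun f => ?_)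
    (fun f => hbar_lmul c f) (fun f => ?_) (raises_lmul (mem_filt_zero _)) Raises.zero
  · rwa [add_zero] at this
  · simp [lmul_lmul_comm hF]
  · simp
  · simp

theorem conj_hbar (F : Series 𝕜 p) : Conj F hbar hbar := by
  have := conj_of_step (F := F) (T := hbar) (T₁ := 0) (fun f => ?_) (fun f => ?_)
    (fun f => rfl) (fun f => ?_) (raises_hbar.mono (by omega)) Raises.zero
  · rwa [add_zero] at this
  · simp [hbar_lmul]
  · simp
  · simp

theorem conj_one (F : Series 𝕜 p) : Conj F 1 1 := by
  have := conj_of_step (F := F) (T := 1) (T₁ := 0) (fun f => ?_) (fun f => ?_)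
    (fun f => rfl) (fun f => ?_) Raises.one Raises.zero
  · rwa [add_zero] at this
  · simp
  · simp
  · simp

/-- By the Leibniz rule the first flow term is multiplication by ∂_aF, which commutes with F, so the
flow stops there. -/
theorem conj_hbar_pd {F : Series 𝕜 p} (hF : IsHomog 0 F) (hF3 : F ∈ filt 𝕜 p 3) (a : σ) :
    Conj F (hbar * pd a) (hbar * pd a + lmul (pd a F)) := by
  refine conj_of_step (fun f => ?_) (fun f => ?_) (fun f => ?_) (fun f => hbar_lmul _ _)
    ((raises_hbar_pd a).mono (by omega)) ((raises_lmul (pd_mem_filt a hF3)).mono (by omega))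
  · simp only [Module.End.mul_apply, pd_lmul a hF, map_add, hbar_lmul]
    abel
  · exact (lmul_lmul_comm hF _ _).symm
  · simp only [Module.End.mul_apply, hbar_pd]

/-! ### Conjugation and pointwise limits. -/

theorem TendstoPt.adDiv {α : Type*} {l : Filter α} {S : α → Module.End 𝕜 (Series 𝕜 p)}
    {T : Module.End 𝕜 (Series 𝕜 p)} (h : TendstoPt l S T) (F : Series 𝕜 p) :
    TendstoPt l (fun a => adDiv F (S a)) (adDiv F T) := by
  intro f d
  filter_upwards [h (lmul F f) (d + 2), h f (d + 2)] with a h1 h2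
  rw [adDiv_apply, adDiv_apply, ← map_sub]
  refine divHbar_mem_filt ?_
  rw [sub_sub_sub_comm, ← map_sub]
  exact sub_mem h1 (raises_lmul (mem_filt_zero F) _ _ h2)

theorem TendstoPt.iterate_adDiv {α : Type*} {l : Filter α} {S : α → Module.End 𝕜 (Series 𝕜 p)}
    {T : Module.End 𝕜 (Series 𝕜 p)} (h : TendstoPt l S T) (F : Series 𝕜 p) (n : ℕ) :
    TendstoPt l (fun a => (SuperAiry.adDiv F)^[n] (S a)) ((SuperAiry.adDiv F)^[n] T) := by
  induction n with
  | zero => exact h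
  | succ n ih =>
    simp only [Function.iterate_succ_apply']
    exact ih.adDiv F

theorem TendstoPt.flow [CharZero 𝕜] {α : Type*} {l : Filter α}
    {S : α → Module.End 𝕜 (Series 𝕜 p)} {T : Module.End 𝕜 (Series 𝕜 p)} {F : Series 𝕜 p}
    (h : TendstoPt l S T) {e : α → ℕ → Module.End 𝕜 (Series 𝕜 p)}
    (he : ∀ a, IsFlow F (S a) (e a)) (n : ℕ) :
    TendstoPt l (fun a => e a n) ((n.factorial : 𝕜)⁻¹ • (SuperAiry.adDiv F)^[n] T) := by
  intro f d
  filter_upwards [h.iterate_adDiv F n f d] with a ha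
  have := Submodule.smul_mem _ (n.factorial : 𝕜)⁻¹ ha
  rw [smul_sub] at this
  rwa [(he a).eq_inv_smul, LinearMap.smul_apply]

/-- Modulo degree d only the first d flow terms contribute, and each of them depends continuously on
the operator. -/
theorem Conj.tendstoPt [CharZero 𝕜] {α : Type*} {l : Filter α} {F : Series 𝕜 p}
    {S S' : α → Module.End 𝕜 (Series 𝕜 p)} {T T' : Module.End 𝕜 (Series 𝕜 p)}
    (hS : ∀ a, Conj F (S a) (S' a)) (hT : Conj F T T') (h : TendstoPt l S T) :
    TendstoPt l S' T' := by
  choose e he hS' using hS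
  obtain ⟨e', he', hT'⟩ := hT
  intro f d
  have h1 : ∀ᶠ a in l, ∀ n ∈ range d, e a n f - e' n f ∈ filt 𝕜 p d := by
    rw [Filter.eventually_all_finset]
    intro n _
    filter_upwards [h.flow he n f d] with a ha
    rwa [LinearMap.smul_apply, ← he'.eq_inv_smul] at ha
  filter_upwards [h1] with a ha
  have := add_mem (sub_mem (hS' a d f) (hT' d f)) (sum_mem ha)
  rw [sum_sub_distrib] at this
  convert this using 1
  abel

/-- The candidate flow of the limit is obtained by iterated division, whose exactness is not known
beforehand. Its terms are limits of the given flow terms, and the recursion multiplied by ħ passes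
to the limit. -/
theorem Conj.of_tendstoPt [CharZero 𝕜] {α : Type*} {l : Filter α} [l.NeBot] {F : Series 𝕜 p}
    {S S' : α → Module.End 𝕜 (Series 𝕜 p)} {T T' : Module.End 𝕜 (Series 𝕜 p)}
    (hS : ∀ a, Conj F (S a) (S' a)) (h : TendstoPt l S T) (h' : TendstoPt l S' T') :
    Conj F T T' := by
  choose e he hS' using hS
  set E : ℕ → Module.End 𝕜 (Series 𝕜 p) :=
    fun n => (n.factorial : 𝕜)⁻¹ • (SuperAiry.adDiv F)^[n] T with hE
  have hlim : ∀ n, TendstoPt l (fun a => e a n) (E n) := fun n => h.flow he n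
  refine ⟨E, ⟨by simp [hE], fun n f => ?_, fun n f => ?_, fun n d f hf => ?_⟩, fun N f => ?_⟩
  · refine eq_of_sub_mem_filt fun d => ?_
    obtain ⟨a, h1, h2, h3⟩ := ((hlim (n + 1) f d).and
      ((hlim n (lmul F f) d).and (hlim n f d))).exists
    have h4 := raises_hbar _ _ (Submodule.smul_mem _ ((n + 1 : ℕ) : 𝕜) h1)
    have h5 := raises_lmul (mem_filt_zero F) _ _ h3
    rw [smul_sub, map_sub, (he a).step] at h4
    rw [map_sub] at h5
    have := sub_mem (sub_mem h2 h5) (filt_anti (by omega) h4)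
    convert this using 1
    abel
  · refine eq_of_sub_mem_filt fun d => ?_
    obtain ⟨a, h1, h2⟩ := ((hlim n f d).and (hlim n (hbar f) d)).exists
    have h4 := raises_hbar _ _ h1
    rw [map_sub, (he a).comm] at h4
    have := sub_mem h2 (filt_anti (by omega) h4)
    convert this using 1
    abel
  · obtain ⟨a, h1⟩ := (hlim n f (d + n)).exists
    have := sub_mem ((he a).raises n d f hf) h1
    rwa [sub_sub_cancel] at this
  · have h1 : ∀ᶠ a in l, ∀ n ∈ range N, e a n f - E n f ∈ filt 𝕜 p N := by
      rw [Filter.eventually_all_finset]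
      exact fun n _ => hlim n f N
    obtain ⟨a, h2, h3⟩ := (h1.and (h' f N)).exists
    have := add_mem (sub_mem (hS' a N f) h3) (sum_mem h2)
    rw [sum_sub_distrib] at this
    convert this using 1
    abel

theorem Conj.psi_eq [CharZero 𝕜] {F : Series 𝕜 p} (hF : IsHomog 0 F)
    {T T' : Module.End 𝕜 (Series 𝕜 p)} (h : Conj F T T') (f : Series 𝕜 p) :
    psi F T f = fun μ => coeff μ (T' f) := by
  obtain ⟨e, he, hT⟩ := h
  funext μ
  have hD : (fun T => -(divHbar * superComm (lmul F) T)) = adDiv F := by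
    funext T
    rw [superComm_lmul_of_even hF]
    refine LinearMap.ext fun f => ?_
    change -(divHbar (lmul F (T f) - T (lmul F f))) = divHbar (T (lmul F f) - lmul F (T f))
    rw [← map_neg, neg_sub]
  have h1 : ∀ n : ℕ, (n.factorial : 𝕜)⁻¹ * coeff μ ((adDiv F)^[n] T f) = (e n f).1 μ := by
    intro n
    rw [he.eq_inv_smul]
    rfl
  unfold psi
  simp only [hD, h1]
  -- The n-th term raises degrees by at least n, so terms with n > deg μ do not reach the
  -- coefficient μ.
  rw [finsum_eq_sum_of_support_subset (s := range (deg μ + 1))]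
  · have := hT (deg μ + 1) f μ (by omega)
    rw [Submodule.coe_sub, Pi.sub_apply, sub_eq_zero, Submodule.coe_sum, Finset.sum_apply] at this
    exact this.symm
  · intro n hn
    rw [coe_range, Set.mem_Iio]
    by_contra h2
    exact hn ((he.raises n).apply f μ (by omega))

end

section

variable {𝕜 : Type*} [Field 𝕜] {σ : Type*} [LinearOrder σ] {p : σ → ZMod 2}

/-! ### Words -/

/-- The letters of `J` in increasing order, with multiplicity. -/
def word (J : σ →₀ ℕ) : List σ := (J.support.sort (· ≤ ·)).flatMap fun a => List.replicate (J a) a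

/-- The product of the operators `A a` along a word. -/
def wordProd (A : σ → Module.End 𝕜 (Series 𝕜 p)) (w : List σ) : Module.End 𝕜 (Series 𝕜 p) :=
  (w.map A).prod

theorem wordProd_cons (A : σ → Module.End 𝕜 (Series 𝕜 p)) (a : σ) (w : List σ) :
    wordProd A (a :: w) = A a * wordProd A w := by simp [wordProd]

theorem wordProd_nil (A : σ → Module.End 𝕜 (Series 𝕜 p)) : wordProd A [] = 1 := rfl

theorem orderedPow_eq_wordProd (A : σ → Module.End 𝕜 (Series 𝕜 p)) (J : σ →₀ ℕ) :
    orderedPow A J = wordProd A (word J) := by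
  unfold orderedPow wordProd word
  induction J.support.sort (· ≤ ·) with
  | nil => rfl
  | cons a l ih => simp [ih]

theorem sum_map_word {M : Type*} [AddCommMonoid M] (g : σ → M) (J : σ →₀ ℕ) :
    ((word J).map g).sum = J.sum fun a n => n • g a := by
  have h1 : ∀ l : List σ, ((l.flatMap fun a => List.replicate (J a) a).map g).sum =
      (l.map fun a => J a • g a).sum := by
    intro l
    induction l with
    | nil => rfl
    | cons a l ih => simp [ih]
  unfold word
  rw [h1, Finset.sum_list_map_count, Finset.sort_toFinset]
  refine Finset.sum_congr rfl fun a ha => ?_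
  rw [List.count_eq_one_of_mem (Finset.sort_nodup _ _) ((Finset.mem_sort _).2 ha), one_smul]

theorem length_word (J : σ →₀ ℕ) : (word J).length = J.degree := by
  have h1 : ∀ l : List σ, (l.map fun _ => 1).sum = l.length := by simp
  rw [← h1, sum_map_word]
  simp [Finsupp.degree_apply, Finsupp.sum]

theorem word_injective : Function.Injective (word : (σ →₀ ℕ) → List σ) := by
  intro J K h
  have key : ∀ (J : σ →₀ ℕ) (a : σ), ((word J).map fun b => if b = a then 1 else 0).sum = J a := by
    intro J a
    rw [sum_map_word, Finsupp.sum]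
    simp [eq_comm]
  ext a
  rw [← key J a, ← key K a, h]

theorem word_single (a : σ) : word (Finsupp.single a 1) = [a] := by
  unfold word
  rw [Finsupp.support_single _ one_ne_zero]
  simp

theorem orderedPow_single (A : σ → Module.End 𝕜 (Series 𝕜 p)) (a : σ) :
    orderedPow A (Finsupp.single a 1) = A a := by
  rw [orderedPow_eq_wordProd, word_single, wordProd_cons, wordProd_nil, mul_one]

/-! ### Normally ordered series in a family of operators -/

/-- A family of operators of positive degree that tends to zero pointwise. -/
structure Tame (A : σ → Module.End 𝕜 (Series 𝕜 p)) : Prop where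
  raises : ∀ a, Raises 1 (A a)
  finite : ∀ f d, {a | A a f ∉ filt 𝕜 p d}.Finite

theorem raises_wordProd {A : σ → Module.End 𝕜 (Series 𝕜 p)} (h : ∀ a, Raises 1 (A a))
    (w : List σ) : Raises w.length (wordProd A w) := by
  induction w with
  | nil => exact Raises.one
  | cons a w ih =>
    rw [wordProd_cons, List.length_cons, add_comm]
    exact (h a).mul ih

theorem raises_orderedPow {A : σ → Module.End 𝕜 (Series 𝕜 p)} (h : ∀ a, Raises 1 (A a))
    (J : σ →₀ ℕ) : Raises J.degree (orderedPow A J) := by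
  rw [orderedPow_eq_wordProd, ← length_word]
  exact raises_wordProd h _

/-- The last letter of a word acts first. If it sends f to degree at least d, the remaining letters
keep it there, so only finitely many last letters matter. -/
theorem Tame.finite_words {A : σ → Module.End 𝕜 (Series 𝕜 p)} (hA : Tame A) (k : ℕ)
    (f : Series 𝕜 p) (d : ℕ) :
    {w : List σ | w.length = k ∧ wordProd A w f ∉ filt 𝕜 p d}.Finite := by
  induction k generalizing f with
  | zero => exact (Set.finite_singleton []).subset fun w hw => List.length_eq_zero_iff.1 hw.1
  | succ k ih =>
    refine ((hA.finite f d).biUnion fun a _ => (ih (A a f)).image fun w => w ++ [a]).subset ?_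
    rintro w ⟨h1, h2⟩
    rcases List.eq_nil_or_concat w with rfl | ⟨w, a, rfl⟩
    · simp at h1
    · have e : wordProd A (w ++ [a]) f = wordProd A w (A a f) := by simp [wordProd]
      rw [List.concat_eq_append, e] at h2
      simp only [Set.mem_iUnion]
      refine ⟨a, fun h => h2 (filt_anti (by omega) (raises_wordProd hA.raises w _ _ h)), w,
        ⟨by simpa using h1, h2⟩, by simp⟩

/-- A product of d or more operators lands in degree at least d, which leaves finitely many word
lengths, each with finitely many relevant words. -/
theorem Tame.finite_terms {A : σ → Module.End 𝕜 (Series 𝕜 p)} (hA : Tame A) (c : Weyl 𝕜 p)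
    (f : Series 𝕜 p) (d : ℕ) :
    {J | lmul (c J) (orderedPow A J.1 f) ∉ filt 𝕜 p d}.Finite := by
  have h := (Set.finite_Iio d).biUnion fun k _ => hA.finite_words k f d
  refine (h.preimage (f := fun J : {J : σ →₀ ℕ // Admissible p J} => word J.1)
    (word_injective.comp Subtype.val_injective).injOn).subset ?_
  intro J hJ
  have h1 : orderedPow A J.1 f ∉ filt 𝕜 p d := fun h => hJ (by
    simpa using lmul_mem_filt (mem_filt_zero (c J)) h)
  simp only [Set.mem_preimage, Set.mem_iUnion]
  refine ⟨(word J.1).length, ?_, rfl, by rwa [← orderedPow_eq_wordProd]⟩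
  rw [Set.mem_Iio]
  by_contra h2
  rw [length_word, not_lt] at h2
  exact h1 (filt_anti h2 ((raises_orderedPow hA.raises _).apply f))

theorem Tame.finite_support {A : σ → Module.End 𝕜 (Series 𝕜 p)} (hA : Tame A) (c : Weyl 𝕜 p)
    (f : Series 𝕜 p) (μ : (σ →₀ ℕ) × ℕ) :
    (Function.support fun J => (lmul (c J) (orderedPow A J.1 f)).1 μ).Finite :=
  (hA.finite_terms c f (deg μ + 1)).subset fun _ h h' => h (h' μ (Nat.lt_succ_self _))

/-- The operator `∑_J c_J A^J`. -/
def opG (A : σ → Module.End 𝕜 (Series 𝕜 p)) (hA : Tame A) (c : Weyl 𝕜 p) :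
    Module.End 𝕜 (Series 𝕜 p) where
  toFun f := ⟨fun μ => ∑ᶠ J, (lmul (c J) (orderedPow A J.1 f)).1 μ, by
    refine ⟨fun μ h => ?_, fun d => ?_⟩
    · obtain ⟨J, hJ⟩ := exists_of_finsum_ne_zero h
      exact (lmul (c J) _).2.1 μ hJ
    · refine ((hA.finite_terms c f (d + 1)).biUnion fun J _ => (lmul (c J)
        (orderedPow A J.1 f)).2.2 d).subset ?_
      rintro μ ⟨h, hd⟩
      obtain ⟨J, hJ⟩ := exists_of_finsum_ne_zero h
      simp only [Set.mem_iUnion]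
      exact ⟨J, fun h => hJ (h μ (by omega)), hJ, hd⟩⟩
  map_add' f g := by
    apply Subtype.ext; funext μ
    simp only [map_add, Submodule.coe_add, Pi.add_apply]
    exact finsum_add_distrib (hA.finite_support c f μ) (hA.finite_support c g μ)
  map_smul' r f := by
    apply Subtype.ext; funext μ
    simp only [map_smul, Submodule.coe_smul, Pi.smul_apply, RingHom.id_apply]
    exact (smul_finsum r _).symm

theorem opG_apply {A : σ → Module.End 𝕜 (Series 𝕜 p)} (hA : Tame A) (c : Weyl 𝕜 p)
    (f : Series 𝕜 p) (μ : (σ →₀ ℕ) × ℕ) :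
    (opG A hA c f).1 μ = ∑ᶠ J, (lmul (c J) (orderedPow A J.1 f)).1 μ := rfl

/-- The finite partial sums of `opG`. -/
def partialOp (A : σ → Module.End 𝕜 (Series 𝕜 p)) (c : Weyl 𝕜 p)
    (s : Finset {J : σ →₀ ℕ // Admissible p J}) : Module.End 𝕜 (Series 𝕜 p) :=
  ∑ J ∈ s, lmul (c J) * orderedPow A J.1

theorem partialOp_apply (A : σ → Module.End 𝕜 (Series 𝕜 p)) (c : Weyl 𝕜 p)
    (s : Finset {J : σ →₀ ℕ // Admissible p J}) (f : Series 𝕜 p) :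
    partialOp A c s f = ∑ J ∈ s, lmul (c J) (orderedPow A J.1 f) := by
  rw [partialOp, LinearMap.sum_apply]
  rfl

theorem tendstoPt_partialOp {A : σ → Module.End 𝕜 (Series 𝕜 p)} (hA : Tame A) (c : Weyl 𝕜 p) :
    TendstoPt Filter.atTop (partialOp A c) (opG A hA c) := by
  intro f d
  filter_upwards [Filter.eventually_ge_atTop (hA.finite_terms c f d).toFinset] with s hs
  intro μ hμ
  rw [partialOp_apply, Submodule.coe_sub, Pi.sub_apply, sub_eq_zero, Submodule.coe_sum,
    Finset.sum_apply, opG_apply]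
  refine (finsum_eq_sum_of_support_subset _ fun J hJ => ?_).symm
  refine hs ((Set.Finite.mem_toFinset _).2 fun h => hJ (h μ hμ))

/-- The component of each degree is a polynomial, so only finitely many variables occur in low
degree. -/
theorem finite_pd_notMem (f : Series 𝕜 p) (d : ℕ) : {a | pd a f ∉ filt 𝕜 p d}.Finite := by
  refine ((finite_deg_le f d).biUnion fun μ _ => μ.1.support.finite_toSet).subset ?_
  intro a ha
  simp only [Set.mem_ofPred_eq, mem_filt, not_forall] at ha
  obtain ⟨μ, hμ, h⟩ := ha
  simp only [Set.mem_iUnion]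
  exact ⟨(μ.1 + Finsupp.single a 1, μ.2), ⟨right_ne_zero_of_mul h, by
    simp only [deg, map_add, Finsupp.degree_single] at hμ ⊢; omega⟩, by simp⟩

theorem tame_hbar_pd : Tame fun a => (hbar * pd a : Module.End 𝕜 (Series 𝕜 p)) :=
  ⟨raises_hbar_pd, fun f d => (finite_pd_notMem f d).subset fun _ ha h =>
    ha (filt_anti (by omega) (raises_hbar _ _ h))⟩

theorem tame_lmul_pd {F : Series 𝕜 p} (hF : F ∈ filt 𝕜 p 3) :
    Tame fun a => lmul (pd a F) :=
  ⟨fun a => (raises_lmul (pd_mem_filt a hF)).mono (by omega),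
    fun f d => (finite_pd_notMem F d).subset fun _ ha h =>
    ha (by simpa using lmul_mem_filt h (mem_filt_zero f))⟩

theorem Tame.add {A B : σ → Module.End 𝕜 (Series 𝕜 p)} (hA : Tame A) (hB : Tame B) :
    Tame fun a => A a + B a :=
  ⟨fun a => (hA.raises a).add (hB.raises a), fun f d =>
    ((hA.finite f d).union (hB.finite f d)).subset fun a ha => by
      by_contra h
      simp only [Set.mem_union, Set.mem_ofPred_eq, not_or, not_not] at h
      exact ha (add_mem h.1 h.2)⟩

/-- The conjugate of `ħ∂_a` by `exp (F / ħ)`. -/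
def conjPd (F : Series 𝕜 p) (a : σ) : Module.End 𝕜 (Series 𝕜 p) := hbar * pd a + lmul (pd a F)

theorem tame_conjPd {F : Series 𝕜 p} (hF : F ∈ filt 𝕜 p 3) : Tame (conjPd F) :=
  tame_hbar_pd.add (tame_lmul_pd hF)

theorem op_eq_opG (c : Weyl 𝕜 p) : op c = opG _ tame_hbar_pd c := rfl

/-- The finite partial sums are polynomial in multiplications and the ħ∂_a, so they are conjugated
factor by factor; the full series is their pointwise limit. -/
theorem conj_op [CharZero 𝕜] {F : Series 𝕜 p} (hF : IsHomog 0 F) (hF3 : F ∈ filt 𝕜 p 3)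
    (c : Weyl 𝕜 p) : Conj F (op c) (opG (conjPd F) (tame_conjPd hF3) c) := by
  rw [op_eq_opG]
  refine Conj.of_tendstoPt (fun s => ?_) (tendstoPt_partialOp tame_hbar_pd c)
    (tendstoPt_partialOp (tame_conjPd hF3) c)
  refine Conj.sum s fun J _ => (conj_lmul hF _).mul ?_
  rw [orderedPow_eq_wordProd, orderedPow_eq_wordProd]
  induction word J.1 with
  | nil => exact conj_one F
  | cons a w ih =>
    rw [wordProd_cons, wordProd_cons]
    exact (conj_hbar_pd hF hF3 a).mul ih

/-! ### Dependence on the family of operators -/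

/-- Telescoping along the word: changing one letter gains r degrees beyond the word length. -/
theorem raises_wordProd_sub {A B : σ → Module.End 𝕜 (Series 𝕜 p)} (hA : ∀ a, Raises 1 (A a))
    (hB : ∀ a, Raises 1 (B a)) {r : ℕ} (h : ∀ a, Raises (r + 1) (A a - B a)) (w : List σ) :
    Raises (w.length + r) (wordProd A w - wordProd B w) := by
  induction w with
  | nil =>
    intro d f _
    change f - f ∈ _
    rw [sub_self]
    exact zero_mem _
  | cons a w ih =>
    intro d f hf
    have h1 := ((hA a).mul ih) d f hf
    have h2 := ((h a).mul (raises_wordProd hB w)) d f hf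
    have e : (wordProd A (a :: w) - wordProd B (a :: w)) f =
        A a (wordProd A w f - wordProd B w f) + (A a - B a) (wordProd B w f) := by
      rw [wordProd_cons, wordProd_cons, map_sub]
      exact (sub_add_sub_cancel _ _ _).symm
    rw [e]
    refine add_mem (filt_anti ?_ h1) (filt_anti ?_ h2) <;> simp <;> omega

/-- The subtraction is truncated: nothing is claimed for multi-indices of degree two or more. -/
theorem coeff_mem_filt_of_truncWeyl {c : Weyl 𝕜 p} {a : σ} (hc : truncWeyl 1 c = hbarPd a)
    (J : {J : σ →₀ ℕ // Admissible p J}) :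
    c J - hbarPd a J ∈ filt 𝕜 p (2 - J.1.degree) := by
  intro μ hμ
  have h1 : J.1.degree ≤ 1 := by omega
  have h2 : truncWeyl 1 c J = truncSeries (1 - J.1.degree) (c J) := if_pos h1
  rw [hc] at h2
  rw [h2, Submodule.coe_sub, Pi.sub_apply, sub_eq_zero]
  exact (if_pos (by omega)).symm

theorem admissible_single (a : σ) : Admissible p (Finsupp.single a 1) := fun b _ => by
  rw [Finsupp.single_apply]
  split_ifs <;> simp

/-- Once the contribution of ħ∂_a is removed, the coefficient at J starts in degree 2 - |J|, while
the two ordered products of index J differ by an operator raising degrees by |J| + r. The same bound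
serves the contraction, classical uniqueness and, with B = 0, the leading term. -/
theorem opG_sub_opG_mem_filt {A B : σ → Module.End 𝕜 (Series 𝕜 p)} (hA : Tame A) (hB : Tame B)
    {r : ℕ} (h : ∀ a, Raises (r + 1) (A a - B a)) {c : Weyl 𝕜 p} {a : σ}
    (hc : truncWeyl 1 c = hbarPd a) {d : ℕ} {f : Series 𝕜 p} (hf : f ∈ filt 𝕜 p d) :
    opG A hA c f - opG B hB c f - (A a f - B a f) ∈ filt 𝕜 p (d + r + 2) := by
  classical
  let J₀ : {J : σ →₀ ℕ // Admissible p J} := ⟨Finsupp.single a 1, admissible_single a⟩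
  obtain ⟨s, h1, h2, h3⟩ := ((tendstoPt_partialOp hA c f (d + r + 2)).and
    ((tendstoPt_partialOp hB c f (d + r + 2)).and (Filter.eventually_ge_atTop {J₀}))).exists
  have hJ₀ : J₀ ∈ s := h3 (mem_singleton_self _)
  have h4 : partialOp A c s f - partialOp B c s f - (A a f - B a f) ∈ filt 𝕜 p (d + r + 2) := by
    have e : A a f - B a f = ∑ J ∈ s, lmul (hbarPd a J)
        ((orderedPow A J.1 - orderedPow B J.1) f) := by
      rw [sum_eq_single_of_mem J₀ hJ₀ fun J _ hJ => ?_]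
      · have e1 : (hbarPd a J₀ : Series 𝕜 p) = one := if_pos rfl
        rw [e1, one_lmul, LinearMap.sub_apply, orderedPow_single, orderedPow_single]
      · have e1 : (hbarPd a J : Series 𝕜 p) = 0 := if_neg fun h => hJ (Subtype.ext h)
        rw [e1, lmul_zero]
        rfl
    rw [e, partialOp_apply, partialOp_apply, ← sum_sub_distrib, ← sum_sub_distrib]
    refine sum_mem fun J _ => ?_
    rw [← map_sub, ← LinearMap.sub_apply, ← LinearMap.sub_apply, ← lmul_sub]
    have h5 := raises_wordProd_sub hA.raises hB.raises h (word J.1) d f hf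
    rw [length_word, ← orderedPow_eq_wordProd, ← orderedPow_eq_wordProd] at h5
    exact filt_anti (by omega) (lmul_mem_filt (coeff_mem_filt_of_truncWeyl hc J) h5)
  have := add_mem (sub_mem h2 h1) h4
  have := sub_mem (add_mem h4 h2) h1
  convert this using 1
  abel

theorem coeff_zero_mem_filt {c : Weyl 𝕜 p} {a : σ} (hc : truncWeyl 1 c = hbarPd a) :
    c ⟨0, admissible_zero⟩ ∈ filt 𝕜 p 2 := by
  have h := coeff_mem_filt_of_truncWeyl hc ⟨0, admissible_zero⟩
  have e : (hbarPd a ⟨0, admissible_zero⟩ : Series 𝕜 p) = 0 :=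
    if_neg fun h => by simpa using h.symm
  rwa [e, sub_zero, map_zero] at h

theorem tame_zero : Tame fun _ : σ => (0 : Module.End 𝕜 (Series 𝕜 p)) :=
  ⟨fun _ => Raises.zero, fun f d => by simp⟩

theorem opG_zero (c : Weyl 𝕜 p) (f : Series 𝕜 p) :
    opG _ tame_zero c f = lmul (c ⟨0, admissible_zero⟩) f := by
  refine Series.ext fun μ => ?_
  change ∑ᶠ J, _ = _
  rw [finsum_eq_single _ ⟨0, admissible_zero⟩]
  · rw [orderedPow_eq_wordProd]
    simp [word, wordProd, coeff]
  · intro J hJ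
    have h0 : word J.1 ≠ [] := fun h => hJ <| Subtype.ext <| word_injective <| by
      rw [h]; simp [word]
    rw [orderedPow_eq_wordProd]
    obtain ⟨a, w, hw⟩ := List.exists_cons_of_ne_nil h0
    rw [hw, wordProd_cons, zero_mul]
    simp

/-- The linear part of `c` determines the leading term of the associated operator. -/
theorem opG_sub_mem_filt {A : σ → Module.End 𝕜 (Series 𝕜 p)} (hA : Tame A) {c : Weyl 𝕜 p} {a : σ}
    (hc : truncWeyl 1 c = hbarPd a) {d : ℕ} {f : Series 𝕜 p} (hf : f ∈ filt 𝕜 p d) :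
    opG A hA c f - A a f ∈ filt 𝕜 p (d + 2) := by
  have h1 := opG_sub_opG_mem_filt (r := 0) hA tame_zero
    (fun a => (hA.raises a).sub Raises.zero) hc hf
  have h2 := lmul_mem_filt (coeff_zero_mem_filt hc) hf
  rw [opG_zero, LinearMap.zero_apply, sub_zero] at h1
  rw [add_comm] at h2
  convert add_mem h1 h2 using 1
  abel

/-! ### Parity -/

theorem parityShift_one : ParityShift 0 (1 : Module.End 𝕜 (Series 𝕜 p)) := fun β f hf => by
  rwa [zero_add]

theorem ParityShift.mul {α β : ZMod 2} {S T : Module.End 𝕜 (Series 𝕜 p)}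
    (hS : ParityShift α S) (hT : ParityShift β T) : ParityShift (α + β) (S * T) :=
  fun _ _ hf => by
    rw [add_assoc]
    exact hS _ _ (hT _ _ hf)

theorem ParityShift.add {α : ZMod 2} {S T : Module.End 𝕜 (Series 𝕜 p)}
    (hS : ParityShift α S) (hT : ParityShift α T) : ParityShift α (S + T) :=
  fun _ _ hf => (hS _ _ hf).add (hT _ _ hf)

theorem parityShift_orderedPow {A : σ → Module.End 𝕜 (Series 𝕜 p)}
    (h : ∀ a, ParityShift (p a) (A a)) (J : σ →₀ ℕ) :
    ParityShift (monParity p J) (orderedPow A J) := by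
  have e : monParity p J = ((word J).map p).sum := by
    rw [sum_map_word]
    simp [monParity]
  rw [e, orderedPow_eq_wordProd]
  induction word J with
  | nil => exact parityShift_one
  | cons a w ih =>
    rw [wordProd_cons, List.map_cons, List.sum_cons]
    exact (h a).mul ih

theorem parityShift_opG {A : σ → Module.End 𝕜 (Series 𝕜 p)} (hA : Tame A)
    (h : ∀ a, ParityShift (p a) (A a)) {α : ZMod 2} {c : Weyl 𝕜 p} (hc : HasParity α c) :
    ParityShift α (opG A hA c) := by
  intro β f hf μ hμ
  obtain ⟨J, hJ⟩ := exists_of_finsum_ne_zero hμ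
  have h1 : IsHomog (α + monParity p J.1) (c J) := by
    intro ν hν
    rw [← hc J ν hν, add_assoc, CharTwo.add_self_eq_zero, add_zero]
  have := (h1.lmul (parityShift_orderedPow h J.1 β f hf)) μ hJ
  rw [this, add_assoc, ← add_assoc (monParity p J.1), CharTwo.add_self_eq_zero, zero_add]

theorem parityShift_hbar_pd (a : σ) :
    ParityShift (p a) (hbar * pd a : Module.End 𝕜 (Series 𝕜 p)) := by
  intro β f hf
  rw [add_comm]
  exact (hf.pd a).hbar

theorem parityShift_conjPd {F : Series 𝕜 p} (hF : IsHomog 0 F) (a : σ) :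
    ParityShift (p a) (conjPd F a) := by
  refine (parityShift_hbar_pd a).add fun β f hf => ?_
  have := (hF.pd a).lmul hf
  rwa [zero_add] at this

/-! ### The classical limit -/

theorem clSeries_hbar (f : Series 𝕜 p) : clSeries (hbar f) = 0 := by
  refine Series.ext ?_
  rintro ⟨m, k⟩
  rcases k with _ | k <;> simp [coeff, clSeries, hbar]

theorem clSeries_add (f g : Series 𝕜 p) : clSeries (f + g) = clSeries f + clSeries g := by
  refine Series.ext ?_
  rintro ⟨m, k⟩
  rcases k with _ | k <;> simp [coeff, clSeries]

theorem clSeries_one : clSeries (one : Series 𝕜 p) = one := by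
  refine Series.ext ?_
  rintro ⟨m, k⟩
  rcases k with _ | k <;> simp [coeff, clSeries, one]

theorem clSeries_pd (a : σ) (f : Series 𝕜 p) : clSeries (pd a f) = pd a (clSeries f) := by
  refine Series.ext ?_
  rintro ⟨m, k⟩
  rcases k with _ | k <;> simp [coeff, clSeries, pd]

theorem clSeries_lmul (f g : Series 𝕜 p) :
    clSeries (lmul f g) = lmul (clSeries f) (clSeries g) := by
  refine Series.ext ?_
  rintro ⟨m, k⟩
  rcases k with _ | k
  · simp [coeff, clSeries, lmul, mulFun]
  · have h1 : coeff (m, k + 1) (clSeries (lmul f g)) = 0 := by simp [coeff, clSeries]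
    rw [h1, eq_comm]
    by_contra h
    obtain ⟨-, α, β, e, hα, hβ⟩ := mulFun_ne_zero h
    have h2 : α.2 = 0 := by
      by_contra h'
      exact hα (if_neg h')
    have h3 : β.2 = 0 := by
      by_contra h'
      exact hβ (if_neg h')
    have := congrArg Prod.snd e
    simp [h2, h3] at this

/-- Reduction modulo ħ is multiplicative and kills the summand ħ∂_a of each factor, leaving the
substitution of ∂_aF. -/
theorem clSeries_orderedPow_conjPd (F : Series 𝕜 p) (J : σ →₀ ℕ) (f : Series 𝕜 p) :
    clSeries (orderedPow (conjPd F) J f) =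
      orderedPow (fun a => lmul (pd a (clSeries F))) J (clSeries f) := by
  rw [orderedPow_eq_wordProd, orderedPow_eq_wordProd]
  induction word J with
  | nil => rfl
  | cons a w ih =>
    rw [wordProd_cons, wordProd_cons, Module.End.mul_apply, Module.End.mul_apply, ← ih,
      conjPd, LinearMap.add_apply, clSeries_add, Module.End.mul_apply, clSeries_hbar,
      clSeries_lmul, clSeries_pd, zero_add]

theorem substD_cl {F : Series 𝕜 p} (hF : F ∈ filt 𝕜 p 3) (c : Weyl 𝕜 p) :
    substD (cl c) (clSeries F) =
      fun μ => coeff μ (clSeries (opG (conjPd F) (tame_conjPd hF) c one)) := by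
  funext μ
  have h : ∀ J, lmul (cl c J) (orderedPow (fun a => lmul (pd a (clSeries F))) J.1 one) =
      clSeries (lmul (c J) (orderedPow (conjPd F) J.1 one)) := by
    intro J
    rw [clSeries_lmul, clSeries_orderedPow_conjPd, clSeries_one]
    rfl
  unfold substD
  simp only [h]
  by_cases hμ : μ.2 = 0
  · simp only [coeff, clSeries, hμ, if_true]
    rfl
  · simp [coeff, clSeries, hμ]

theorem truncWeyl_cl {c : Weyl 𝕜 p} {a : σ} (hc : truncWeyl 1 c = hbarPd a) :
    truncWeyl 1 (cl c) = hbarPd a := by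
  have h : ∀ J, truncWeyl 1 (cl c) J = clSeries (truncWeyl 1 c J) := by
    intro J
    refine Series.ext fun μ => ?_
    simp only [truncWeyl, cl]
    split_ifs
    · simp only [coeff, clSeries, truncSeries]
      split_ifs <;> rfl
    · simp [coeff, clSeries]
  funext J
  rw [h, hc]
  unfold hbarPd
  split_ifs
  · exact clSeries_one
  · exact Series.ext fun μ => by simp [coeff, clSeries]

end

section

variable {𝕜 : Type*} [Field 𝕜] {σ : Type*} [LinearOrder σ] {p : σ → ZMod 2}

/-! ### Integration of a family of series -/

/-- The number of letters of a monomial that differ from `o`. -/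
def weight (o : σ) (m : σ →₀ ℕ) : ℕ := ∑ a ∈ m.support.erase o, m a

/-- The coefficients of `∑_a x^a G_a`, the sum being over `a ≠ o`. -/
def radialSum (p : σ → ZMod 2) (o : σ) (G : σ → Series 𝕜 p) (μ : (σ →₀ ℕ) × ℕ) : 𝕜 :=
  ∑ a ∈ μ.1.support.erase o, (koszul p (Finsupp.single a 1) (μ.1 - Finsupp.single a 1) : 𝕜) *
    (G a).1 (μ.1 - Finsupp.single a 1, μ.2)

theorem sub_single_add {m : σ →₀ ℕ} {a : σ} (h : m a ≠ 0) :
    m - Finsupp.single a 1 + Finsupp.single a 1 = m :=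
  tsub_add_cancel_of_le (by rw [Finsupp.single_le_iff]; omega)

theorem deg_sub_single {μ : (σ →₀ ℕ) × ℕ} {a : σ} (h : μ.1 a ≠ 0) :
    deg (μ.1 - Finsupp.single a 1, μ.2) + 1 = deg μ := by
  have := congrArg Finsupp.degree (sub_single_add h)
  rw [map_add, Finsupp.degree_single] at this
  simp only [deg]
  omega

theorem exists_of_radialSum_ne_zero {o : σ} {G : σ → Series 𝕜 p} {μ : (σ →₀ ℕ) × ℕ}
    (h : radialSum p o G μ ≠ 0) : ∃ a, a ≠ o ∧ μ.1 a ≠ 0 ∧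
      (G a).1 (μ.1 - Finsupp.single a 1, μ.2) ≠ 0 := by
  obtain ⟨a, ha, h⟩ := exists_ne_zero_of_sum_ne_zero h
  rw [mem_erase, Finsupp.mem_support_iff] at ha
  exact ⟨a, ha.1, ha.2, right_ne_zero_of_mul h⟩

open Classical in
/-- A series `S` with `∂_a S = G_a` for `a ≠ o`, if there is one. -/
def integ (o : σ) (G : σ → Series 𝕜 p) (hG : ∀ d, {a | G a ∉ filt 𝕜 p d}.Finite) : Series 𝕜 p :=
  ⟨fun μ => if Admissible p μ.1 then (weight o μ.1 : 𝕜)⁻¹ * radialSum p o G μ else 0, by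
    refine ⟨fun μ h => by_contra fun h' => h (if_neg h'), fun d => ?_⟩
    refine ((hG d).biUnion fun a _ => (finite_deg_le (G a) d).image
      fun μ => (μ.1 + Finsupp.single a 1, μ.2)).subset ?_
    rintro μ ⟨h, rfl⟩
    dsimp only at h
    split_ifs at h with hμ
    · obtain ⟨a, -, ha, h1⟩ := exists_of_radialSum_ne_zero (right_ne_zero_of_mul h)
      have h2 := deg_sub_single ha
      simp only [Set.mem_iUnion]
      refine ⟨a, fun h3 => h1 (h3 _ (by omega)), _, ⟨h1, by omega⟩, ?_⟩
      exact Prod.ext (sub_single_add ha) rfl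
    · exact absurd rfl h⟩

theorem coeff_pd_sub_single {a : σ} {f : Series 𝕜 p} {μ : (σ →₀ ℕ) × ℕ} (h : μ.1 a ≠ 0) :
    (pd a f).1 (μ.1 - Finsupp.single a 1, μ.2) =
      (μ.1 a : 𝕜) * (koszul p (Finsupp.single a 1) (μ.1 - Finsupp.single a 1) : 𝕜) * f.1 μ := by
  have e : (pd a f).1 (μ.1 - Finsupp.single a 1, μ.2) =
      ((((μ.1 - Finsupp.single a 1 : σ →₀ ℕ) a : ℕ) : 𝕜) + 1) *
      (koszul p (Finsupp.single a 1) (μ.1 - Finsupp.single a 1) : 𝕜) *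
      f.1 (μ.1 - Finsupp.single a 1 + Finsupp.single a 1, μ.2) := rfl
  have e2 : (((μ.1 - Finsupp.single a 1 : σ →₀ ℕ) a : ℕ) : 𝕜) + 1 = (μ.1 a : 𝕜) := by
    rw [← Nat.cast_add_one]
    congr 1
    simp only [Finsupp.tsub_apply, Finsupp.single_eq_same]
    omega
  rw [e, e2, sub_single_add h]

/-- Euler's formula: multiplying by x^a on the left undoes the sign produced by the left derivative
∂_a. -/
theorem radialSum_pd (o : σ) (f : Series 𝕜 p) (μ : (σ →₀ ℕ) × ℕ) :
    radialSum p o (fun a => pd a f) μ = weight o μ.1 * f.1 μ := by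
  unfold radialSum weight
  rw [Nat.cast_sum, sum_mul]
  refine sum_congr rfl fun a ha => ?_
  rw [mem_erase, Finsupp.mem_support_iff] at ha
  rw [coeff_pd_sub_single ha.2]
  linear_combination (μ.1 a : 𝕜) * f.1 μ * koszul_cast_mul_self (𝕜 := 𝕜) (p := p)
    (Finsupp.single a 1) (μ.1 - Finsupp.single a 1)

theorem exists_of_weight_ne_zero {o : σ} {m : σ →₀ ℕ} (h : weight o m ≠ 0) :
    ∃ a, a ≠ o ∧ m a ≠ 0 := by
  obtain ⟨a, ha, h⟩ := exists_ne_zero_of_sum_ne_zero h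
  exact ⟨a, (mem_erase.1 ha).1, h⟩

theorem eq_single_of_weight_eq_zero {o : σ} {m : σ →₀ ℕ} (h : weight o m = 0) :
    m = Finsupp.single o (m o) := by
  ext a
  by_cases ha : a = o
  · rw [ha, Finsupp.single_eq_same]
  · rw [Finsupp.single_eq_of_ne ha]
    by_contra h'
    exact h' (sum_eq_zero_iff.1 h a (by simp [ha, h']))

/-- A closed family `G` with `∑_a x^a G_a = 0` vanishes in lowest degree. -/
theorem mem_filt_succ_of_closed [CharZero 𝕜] {o : σ} {G : σ → Series 𝕜 p} {n : ℕ}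
    (hG : ∀ a, a ≠ o → G a ∈ filt 𝕜 p n)
    (hc : ∀ a b, a ≠ o → b ≠ o →
      pd a (G b) - (parSign (p a * p b) : 𝕜) • pd b (G a) ∈ filt 𝕜 p n)
    (hs : ∀ μ : (σ →₀ ℕ) × ℕ, Admissible p μ.1 → radialSum p o G μ = 0) {b : σ} (hb : b ≠ o) :
    G b ∈ filt 𝕜 p (n + 1) := by
  intro μ hμ
  by_contra h
  have hn : deg μ = n := le_antisymm (by omega) (not_lt.1 fun h' => h (hG b hb μ h'))
  have hm : Admissible p μ.1 := (G b).2.1 μ h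
  have hcl : ∀ a, a ≠ o → μ.1 a ≠ 0 →
      (pd a (G b)).1 (μ.1 - Finsupp.single a 1, μ.2) =
      (parSign (p a * p b) : 𝕜) * (pd b (G a)).1 (μ.1 - Finsupp.single a 1, μ.2) := by
    intro a ha h0
    have h1 := hc a b ha hb (μ.1 - Finsupp.single a 1, μ.2) (by
      have := deg_sub_single h0
      omega)
    exact sub_eq_zero.1 h1
  -- If x^b is odd and occurs in μ, closedness with a = b reads 2 ∂_bG_b = 0 in this degree.
  -- Otherwise μ times x^b is an admissible monomial, and its radial coefficient can be used.
  by_cases hpb : p b = 1 ∧ μ.1 b ≠ 0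
  · have h1 := hcl b hb hpb.2
    rw [hpb.1, mul_one, coeff_pd_sub_single hpb.2] at h1
    have h2 : (parSign 1 : 𝕜) = -1 := by simp [parSign]
    rw [h2] at h1
    have h3 : (μ.1 b : 𝕜) ≠ 0 := by exact_mod_cast hpb.2
    have h4 := mul_ne_zero (mul_ne_zero h3 (koszul_cast_ne_zero (𝕜 := 𝕜) (p := p)
      (Finsupp.single b 1) (μ.1 - Finsupp.single b 1))) h
    have h5 : (2 : 𝕜) * ((μ.1 b : 𝕜) * (koszul p (Finsupp.single b 1)
      (μ.1 - Finsupp.single b 1) : 𝕜) * (G b).1 μ) = 0 := by linear_combination h1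
    exact (mul_ne_zero two_ne_zero h4) h5
  · have hM : Admissible p (μ.1 + Finsupp.single b 1) := by
      intro a ha
      have h1 := hm a ha
      by_cases hab : b = a
      · subst hab
        have h2 : μ.1 b = 0 := by
          by_contra h'
          exact hpb ⟨ha, h'⟩
        simp [h2]
      · simpa [Finsupp.single_apply, hab] using h1
    have h1 := hs (μ.1 + Finsupp.single b 1, μ.2) hM
    set M := μ.1 + Finsupp.single b 1 with hMdef
    -- Closedness expresses each summand of the radial coefficient at M through the single
    -- coefficient of G_b at μ, with factor M a. The sum then has the factor `weight o M`, which is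
    -- positive because M contains b.
    have h2 : ∀ a ∈ M.support.erase o, ((μ.1 b : 𝕜) + 1) *
        ((koszul p (Finsupp.single a 1) (M - Finsupp.single a 1) : 𝕜) *
          (G a).1 (M - Finsupp.single a 1, μ.2)) =
        (M a : 𝕜) * ((koszul p (Finsupp.single b 1) μ.1 : 𝕜) * (G b).1 μ) := by
      intro a ha
      rw [mem_erase, Finsupp.mem_support_iff] at ha
      by_cases hab : a = b
      · subst hab
        rw [hMdef, add_tsub_cancel_right]
        simp
      · have hMa : M a = μ.1 a := by simp [hMdef, Ne.symm hab]
        have h0 : μ.1 a ≠ 0 := hMa ▸ ha.2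
        have h3 := hcl a ha.1 h0
        rw [coeff_pd_sub_single h0] at h3
        obtain ⟨m, hm'⟩ : ∃ m, m = μ.1 - Finsupp.single a 1 := ⟨_, rfl⟩
        have hma : μ.1 = m + Finsupp.single a 1 := by rw [hm', sub_single_add h0]
        have hMa' : M - Finsupp.single a 1 = m + Finsupp.single b 1 := by
          rw [hMdef, hma, add_right_comm, add_tsub_cancel_right]
        have hmb : m b = μ.1 b := by
          rw [hma]
          simp [hab]
        have h4 : (pd b (G a)).1 (m, μ.2) = ((m b : 𝕜) + 1) *
          (koszul p (Finsupp.single b 1) m : 𝕜) * (G a).1 (m + Finsupp.single b 1, μ.2) := rfl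
        rw [← hm', h4, hmb] at h3
        rw [hMa', hMa]
        have h5 : koszul p (Finsupp.single b 1) μ.1 = koszul p (Finsupp.single b 1) m *
            koszul p (Finsupp.single b 1) (Finsupp.single a 1) := by
          rw [hma, koszul_add_right]
        rw [h5, koszul_add_right]
        have h6 := koszul_single_comm (p := p) (b := b) (m := Finsupp.single a 1)
          (fun _ => by simp [hab])
        rw [monParity_single, Nat.cast_one, one_mul, mul_comm (p b)] at h6
        have h7 : (koszul p (Finsupp.single a 1) (Finsupp.single b 1) : 𝕜) *
          (koszul p (Finsupp.single b 1) (Finsupp.single a 1) : 𝕜) =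
            (parSign (p a * p b) : 𝕜) := by
          rw [← Int.cast_mul, h6]
        have h8 := koszul_cast_mul_self (𝕜 := 𝕜) (p := p) (Finsupp.single b 1)
          (Finsupp.single a 1)
        have h9 := koszul_cast_mul_self (𝕜 := 𝕜) (p := p) (Finsupp.single b 1) m
        have h10 := koszul_cast_mul_self (𝕜 := 𝕜) (p := p) (Finsupp.single a 1) m
        rw [← h7] at h3
        push_cast
        generalize (koszul p (Finsupp.single b 1) (Finsupp.single a 1) : 𝕜) = kba at *
        generalize (koszul p (Finsupp.single a 1) (Finsupp.single b 1) : 𝕜) = kab at *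
        generalize (koszul p (Finsupp.single b 1) m : 𝕜) = kb at *
        generalize (koszul p (Finsupp.single a 1) m : 𝕜) = ka at *
        generalize (G a).1 (m + Finsupp.single b 1, μ.2) = ga at *
        generalize (G b).1 μ = gb at *
        generalize (μ.1 b : 𝕜) = y at *
        generalize (μ.1 a : 𝕜) = z at *
        linear_combination (-ka * kb * kba) * h3 + (z * gb * kb * kba) * h10
          - ((y + 1) * ka * kab * ga) * h9 - ((y + 1) * ka * kab * ga * kb * kb) * h8
    have h3 := congrArg (((μ.1 b : 𝕜) + 1) * ·) h1
    simp only [mul_zero] at h3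
    change ((μ.1 b : 𝕜) + 1) * ∑ a ∈ M.support.erase o, _ = 0 at h3
    rw [mul_sum, sum_congr rfl h2, ← sum_mul, ← Nat.cast_sum] at h3
    have hMb : M b ≠ 0 := by simp [hMdef]
    have h4 : ∑ a ∈ M.support.erase o, M a ≠ 0 := by
      intro h4
      exact hMb (sum_eq_zero_iff.1 h4 b (by simp [hb, hMb]))
    exact mul_ne_zero (by exact_mod_cast h4) (mul_ne_zero (koszul_cast_ne_zero _ _) h) h3

/-! ### The fixed point equation for the free energy -/

/-- The series among which free energies are sought. -/
def IsPotential (F : Series 𝕜 p) : Prop :=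
  ∀ μ, coeff μ F ≠ 0 → monParity p μ.1 = 0 ∧ μ.1 ≠ 0 ∧ 3 ≤ deg μ

theorem IsPotential.homog {F : Series 𝕜 p} (h : IsPotential F) : IsHomog 0 F :=
  fun μ hμ => (h μ hμ).1

theorem IsPotential.mem_filt {F : Series 𝕜 p} (h : IsPotential F) : F ∈ filt 𝕜 p 3 :=
  mem_filt_iff_le.2 fun μ hμ => (h μ hμ).2.2

theorem isPotential_zero : IsPotential (0 : Series 𝕜 p) := fun _ h => absurd rfl h

theorem IsPotential.sub {F G : Series 𝕜 p} (hF : IsPotential F) (hG : IsPotential G) :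
    IsPotential (F - G) := by
  intro μ h
  by_cases h0 : F.1 μ = 0
  · refine hG μ fun h1 => h ?_
    have e : coeff μ (F - G) = F.1 μ - coeff μ G := rfl
    rw [e, h0, h1, sub_zero]
  · exact hF μ h0

/-- A monomial of weight zero is a power of ħ, possibly times x^o: the former has no coordinate, the
latter is odd. This is what makes the Euler operator invertible on potentials. -/
theorem IsPotential.weight_ne_zero {F : Series 𝕜 p} (hF : IsPotential F) {o : σ} (ho : p o = 1)
    {μ : (σ →₀ ℕ) × ℕ} (hμ : F.1 μ ≠ 0) : weight o μ.1 ≠ 0 := by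
  intro h
  obtain ⟨h1, h2, -⟩ := hF μ hμ
  have h3 := eq_single_of_weight_eq_zero h
  have h4 := F.2.1 μ hμ o ho
  rcases Nat.le_one_iff_eq_zero_or_eq_one.1 h4 with h5 | h5
  · rw [h5, Finsupp.single_zero] at h3
    exact h2 h3
  · rw [h3, h5, monParity_single, ho] at h1
    exact absurd h1 (by decide)

/-- The part of the axioms of an Airy structure that determines the free energy; the coordinate
`o` has no equation. -/
structure IsAirySystem (o : σ) (c : σ → Weyl 𝕜 p) : Prop where
  odd : p o = 1
  linear : ∀ a, a ≠ o → truncWeyl 1 (c a) = hbarPd a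
  parity : ∀ a, HasParity (p a) (c a)
  tendsto : TendstoPt Filter.cofinite (fun a => op (c a)) 0

/-- The series `ψ_F(c_a) · 1`. -/
def residue (c : σ → Weyl 𝕜 p) (F : Series 𝕜 p) (hF : IsPotential F) (a : σ) : Series 𝕜 p :=
  opG (conjPd F) (tame_conjPd hF.mem_filt) (c a) one

section

variable [CharZero 𝕜] {o : σ} {c : σ → Weyl 𝕜 p}

/-- Conjugation preserves pointwise convergence, so the residues tend to zero with the operators.
Without this the sum of the x^a R_a could have infinitely many terms in one degree. -/
theorem IsAirySystem.finite_residue (hc : IsAirySystem o c) {F : Series 𝕜 p} (hF : IsPotential F)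
    (d : ℕ) : {a | residue c F hF a ∉ filt 𝕜 p d}.Finite := by
  have h := Conj.tendstoPt (fun a => conj_op hF.homog hF.mem_filt (c a)) (conj_zero F)
    hc.tendsto one d
  simpa [Filter.eventually_cofinite, residue] using h

/-- One step of the recursion for the free energy. -/
def nextPotential (hc : IsAirySystem o c) (F : Series 𝕜 p) (hF : IsPotential F) : Series 𝕜 p :=
  F - integ o (residue c F hF) (hc.finite_residue hF)

theorem conjPd_one (F : Series 𝕜 p) (a : σ) : conjPd F a one = pd a F := by
  rw [conjPd, LinearMap.add_apply, Module.End.mul_apply, pd_one, map_zero, lmul_one, zero_add]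

theorem IsAirySystem.residue_mem_filt (hc : IsAirySystem o c) {F : Series 𝕜 p}
    (hF : IsPotential F) {a : σ} (ha : a ≠ o) : residue c F hF a ∈ filt 𝕜 p 2 := by
  have h1 := opG_sub_mem_filt (tame_conjPd hF.mem_filt) (hc.linear a ha) (mem_filt_zero one)
  rw [conjPd_one] at h1
  simpa [residue] using add_mem h1 (pd_mem_filt a hF.mem_filt)

theorem IsAirySystem.isHomog_residue (hc : IsAirySystem o c) {F : Series 𝕜 p}
    (hF : IsPotential F) (a : σ) : IsHomog (p a) (residue c F hF a) := by
  have := parityShift_opG (tame_conjPd hF.mem_filt) (parityShift_conjPd hF.homog) (hc.parity a)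
    0 one isHomog_one
  rwa [add_zero] at this

theorem isPotential_nextPotential (hc : IsAirySystem o c) {F : Series 𝕜 p} (hF : IsPotential F) :
    IsPotential (nextPotential hc F hF) := by
  refine hF.sub fun μ h => ?_
  simp only [coeff, integ] at h
  split_ifs at h with hμ
  · obtain ⟨a, hao, ha, h1⟩ := exists_of_radialSum_ne_zero (right_ne_zero_of_mul h)
    have h2 := deg_sub_single ha
    have h3 := mem_filt_iff_le.1 (hc.residue_mem_filt hF hao) _ h1
    have h4 := hc.isHomog_residue hF a _ h1
    refine ⟨?_, fun h => ha (by simp [h]), by omega⟩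
    rw [← sub_single_add ha, monParity_add, monParity_single, h4, Nat.cast_one, one_mul,
      CharTwo.add_self_eq_zero]
  · exact absurd rfl h

theorem raises_conjPd_sub {F F' : Series 𝕜 p} {d : ℕ} (h : F - F' ∈ filt 𝕜 p (d + 1)) (a : σ) :
    Raises d (conjPd F a - conjPd F' a) := by
  intro e f hf
  have e1 : (conjPd F a - conjPd F' a) f = lmul (pd a (F - F')) f := by
    rw [map_sub, lmul_sub]
    exact add_sub_add_left_eq_sub _ _ _
  rw [e1]
  exact raises_lmul (pd_mem_filt a h) e f hf

/-- The contraction property: the residues differ by ∂_a(F - F') up to degree d + 3, and integrating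
that leading part returns F - F', so it cancels one further degree. -/
theorem nextPotential_sub_mem_filt (hc : IsAirySystem o c) {F F' : Series 𝕜 p}
    (hF : IsPotential F) (hF' : IsPotential F') {d : ℕ} (h : F - F' ∈ filt 𝕜 p (d + 3)) :
    nextPotential hc F hF - nextPotential hc F' hF' ∈ filt 𝕜 p (d + 4) := by
  intro μ hμ
  have hr : ∀ a, a ≠ o →
      residue c F hF a - residue c F' hF' a - pd a (F - F') ∈ filt 𝕜 p (d + 3) := by
    intro a ha
    have := opG_sub_opG_mem_filt (r := d + 1) (tame_conjPd hF.mem_filt)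
      (tame_conjPd hF'.mem_filt) (raises_conjPd_sub h) (hc.linear a ha) (mem_filt_zero one)
    rw [conjPd_one, conjPd_one, ← map_sub] at this
    exact filt_anti (by omega) this
  have e : (nextPotential hc F hF - nextPotential hc F' hF').1 μ =
      (F - F').1 μ - ((integ o _ (hc.finite_residue hF)).1 μ -
        (integ o _ (hc.finite_residue hF')).1 μ) := by
    simp only [nextPotential, Submodule.coe_sub, Pi.sub_apply]
    ring
  rw [e]
  by_cases hA : Admissible p μ.1
  · have h1 : radialSum p o (residue c F hF) μ - radialSum p o (residue c F' hF') μ =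
        radialSum p o (fun a => pd a (F - F')) μ := by
      unfold radialSum
      rw [← sum_sub_distrib]
      refine sum_congr rfl fun a ha => ?_
      rw [mem_erase, Finsupp.mem_support_iff] at ha
      have h2 := hr a ha.1 (μ.1 - Finsupp.single a 1, μ.2) (by
        have := deg_sub_single ha.2
        omega)
      rw [← mul_sub]
      congr 1
      exact sub_eq_zero.1 h2
    simp only [integ, hA, if_true]
    rw [← mul_sub, h1, radialSum_pd]
    by_cases h0 : (F - F').1 μ = 0
    · rw [h0]; simp
    · have h2 : (weight o μ.1 : 𝕜) ≠ 0 := by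
        exact_mod_cast (hF.sub hF').weight_ne_zero hc.odd h0
      rw [inv_mul_cancel_left₀ h2, sub_self]
  · have h0 : (F - F').1 μ = 0 := by
      by_contra h0
      exact hA ((F - F').2.1 μ h0)
    simp [integ, hA, h0]

/-! ### Existence and uniqueness of the fixed point. -/

theorem eq_of_nextPotential_eq (hc : IsAirySystem o c) {F F' : Series 𝕜 p}
    (hF : IsPotential F) (hF' : IsPotential F') (h : nextPotential hc F hF = F)
    (h' : nextPotential hc F' hF' = F') : F = F' := by
  have key : ∀ d, F - F' ∈ filt 𝕜 p (d + 3) := by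
    intro d
    induction d with
    | zero => exact sub_mem hF.mem_filt hF'.mem_filt
    | succ d ih =>
      have := nextPotential_sub_mem_filt hc hF hF' ih
      rwa [h, h'] at this
  exact eq_of_sub_mem_filt fun d => filt_anti (by omega) (key d)

/-- The iterates of `nextPotential`. -/
def potentialSeq (hc : IsAirySystem o c) : ℕ → {F : Series 𝕜 p // IsPotential F}
  | 0 => ⟨0, isPotential_zero⟩
  | n + 1 => ⟨nextPotential hc (potentialSeq hc n).1 (potentialSeq hc n).2,
      isPotential_nextPotential hc _⟩

theorem potentialSeq_succ_sub (hc : IsAirySystem o c) (n : ℕ) :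
    (potentialSeq hc (n + 1)).1 - (potentialSeq hc n).1 ∈ filt 𝕜 p (n + 3) := by
  induction n with
  | zero => exact sub_mem (potentialSeq hc 1).2.mem_filt (potentialSeq hc 0).2.mem_filt
  | succ n ih => exact nextPotential_sub_mem_filt hc _ _ ih

theorem potentialSeq_sub (hc : IsAirySystem o c) (n k : ℕ) :
    (potentialSeq hc (n + k)).1 - (potentialSeq hc n).1 ∈ filt 𝕜 p (n + 3) := by
  induction k with
  | zero => rw [add_zero, sub_self]; exact zero_mem _
  | succ k ih =>
    have h := add_mem (filt_anti (by omega) (potentialSeq_succ_sub hc (n + k))) ih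
    rwa [sub_add_sub_cancel] at h

theorem exists_nextPotential_eq (hc : IsAirySystem o c) :
    ∃ (F : Series 𝕜 p) (hF : IsPotential F), nextPotential hc F hF = F := by
  -- Coefficients of degree k are read off the k-th iterate; from there on they no longer change,
  -- since later iterates differ only in degree at least k + 3.
  let F : Series 𝕜 p := ⟨fun μ => (potentialSeq hc (deg μ)).1.1 μ,
    fun μ h => (potentialSeq hc (deg μ)).1.2.1 μ h, fun d =>
      ((potentialSeq hc d).1.2.2 d).subset fun μ h => ⟨by
        obtain ⟨h, rfl⟩ := h
        exact h, h.2⟩⟩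
  have hF : IsPotential F := fun μ h => (potentialSeq hc (deg μ)).2 μ h
  have hlim : ∀ n, F - (potentialSeq hc n).1 ∈ filt 𝕜 p n := by
    intro n μ hμ
    obtain ⟨k, rfl⟩ := Nat.exists_eq_add_of_le hμ.le
    have := potentialSeq_sub hc (deg μ) k μ (by omega)
    rw [Submodule.coe_sub, Pi.sub_apply, sub_eq_zero] at this ⊢
    exact this.symm
  refine ⟨F, hF, eq_of_sub_mem_filt fun d => ?_⟩
  have h1 := nextPotential_sub_mem_filt hc hF (potentialSeq hc (d + 3)).2 (hlim (d + 3))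
  have h2 := hlim (d + 4)
  have h3 := sub_mem h1 h2
  refine filt_anti (by omega) (?_ : _ ∈ filt 𝕜 p (d + 4))
  convert h3 using 1
  exact (sub_sub_sub_cancel_right _ _ _).symm

/-! ### Fixed points and vanishing residues. -/

theorem radialSum_residue_eq_zero (hc : IsAirySystem o c) {F : Series 𝕜 p} (hF : IsPotential F)
    (h : nextPotential hc F hF = F) (μ : (σ →₀ ℕ) × ℕ) (hμ : Admissible p μ.1) :
    radialSum p o (residue c F hF) μ = 0 := by
  have h1 : (integ o _ (hc.finite_residue hF)).1 μ = 0 := by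
    rw [sub_eq_self.1 h]
    rfl
  simp only [integ, hμ, if_true, mul_eq_zero] at h1
  -- The inverse of the weight is zero only when the weight is zero, and then the radial sum is
  -- empty.
  rcases h1 with h2 | h2
  swap
  · exact h2
  by_contra h0
  obtain ⟨a, hao, ha, -⟩ := exists_of_radialSum_ne_zero h0
  rw [inv_eq_zero, Nat.cast_eq_zero] at h2
  exact ha (sum_eq_zero_iff.1 h2 a (by simp [hao, ha]))

theorem nextPotential_eq_of_residue_eq_zero (hc : IsAirySystem o c) {F : Series 𝕜 p}
    (hF : IsPotential F) (h : ∀ a, a ≠ o → residue c F hF a = 0) :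
    nextPotential hc F hF = F := by
  rw [nextPotential, sub_eq_self]
  refine Series.ext fun μ => ?_
  by_contra h0
  have h1 : (integ o _ (hc.finite_residue hF)).1 μ ≠ 0 := h0
  simp only [integ] at h1
  split_ifs at h1 with hμ
  · obtain ⟨a, hao, ha, h2⟩ := exists_of_radialSum_ne_zero (right_ne_zero_of_mul h1)
    rw [h a hao] at h2
    exact h2 rfl
  · exact h1 rfl

/-- Involutivity forces the residues of a fixed point to vanish. -/
theorem residue_eq_zero (hc : IsAirySystem o c) {F : Series 𝕜 p} (hF : IsPotential F)
    (h : nextPotential hc F hF = F)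
    (hinv : ∀ n, (∀ a, a ≠ o → residue c F hF a ∈ filt 𝕜 p n) → ∀ a b, a ≠ o → b ≠ o →
      ∃ U U', superComm (op (c a)) (op (c b)) = hbar * U ∧ Conj F U U' ∧ U' one ∈ filt 𝕜 p n)
    {a : σ} (ha : a ≠ o) : residue c F hF a = 0 := by
  have key : ∀ n, ∀ a, a ≠ o → residue c F hF a ∈ filt 𝕜 p n := by
    intro n
    induction n with
    | zero => exact fun _ _ => mem_filt_zero _
    | succ n ih =>
      intro b hb
      refine mem_filt_succ_of_closed ih (fun a b ha hb => ?_)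
        (radialSum_residue_eq_zero hc hF h) hb
      obtain ⟨U, U', hU, hUU', hU'⟩ := hinv n ih a b ha hb
      have hop : ∀ a, ParityShift (p a) (op (c a)) := fun a => by
        rw [op_eq_opG]
        exact parityShift_opG _ parityShift_hbar_pd (hc.parity a)
      rw [superComm_of_parityShift (hop a) (hop b)] at hU
      have hcj := fun a => conj_op hF.homog hF.mem_filt (c a)
      have h1 := (((hcj a).mul (hcj b)).sub (((hcj b).mul (hcj a)).smul
        (parSign (p a * p b) : 𝕜)))
      rw [hU] at h1
      -- The commutator is conjugated in two ways, as a combination of products and as ħU;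
      -- uniqueness of the conjugate identifies the results.
      have h2 := LinearMap.congr_fun (h1.unique ((conj_hbar F).mul hUU')) one
      -- Acting on a series of degree at least n, the conjugate of L_a is ħ∂_a up to degree n + 2,
      -- because ∂_aF itself has degree at least two.
      have h3 : ∀ a b, a ≠ o → b ≠ o →
          opG (conjPd F) (tame_conjPd hF.mem_filt) (c a) (residue c F hF b) -
            hbar (pd a (residue c F hF b)) ∈ filt 𝕜 p (n + 2) := by
        intro a b ha hb
        have h4 := opG_sub_mem_filt (tame_conjPd hF.mem_filt) (hc.linear a ha) (ih b hb)
        have h5 := lmul_mem_filt (pd_mem_filt a hF.mem_filt) (ih b hb)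
        rw [add_comm 2 n] at h5
        convert add_mem h4 h5 using 1
        rw [conjPd, LinearMap.add_apply, Module.End.mul_apply]
        abel
      -- Closedness in degree n is proved after multiplication by ħ, which shifts it to degree n +
      -- 2, the order of every error term.
      refine mem_filt_of_hbar_mem ?_
      have h4 : opG (conjPd F) (tame_conjPd hF.mem_filt) (c a) (residue c F hF b) -
          (parSign (p a * p b) : 𝕜) • opG (conjPd F) (tame_conjPd hF.mem_filt) (c b)
            (residue c F hF a) = hbar (U' one) := h2
      have h5 := raises_hbar _ _ hU'
      rw [← h4] at h5
      have h6 := sub_mem (sub_mem h5 (h3 a b ha hb))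
        (Submodule.smul_mem _ (-(parSign (p a * p b) : 𝕜)) (h3 b a hb ha))
      rw [map_sub, map_smul]
      convert h6 using 1
      module
  exact eq_zero_of_mem_filt fun d => key d a ha

/-- Uniqueness of the solution of the classical equations. -/
theorem classical_unique (hc : IsAirySystem o c) {F F' : Series 𝕜 p}
    (hF : ∀ μ, coeff μ F ≠ 0 → μ.2 = 0 ∧ 3 ≤ deg μ)
    (hF' : ∀ μ, coeff μ F' ≠ 0 → μ.2 = 0 ∧ 3 ≤ deg μ)
    (h : ∀ a, a ≠ o → substD (cl (c a)) F = 0) (h' : ∀ a, a ≠ o → substD (cl (c a)) F' = 0) :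
    F = F' := by
  have hf : F ∈ filt 𝕜 p 3 := mem_filt_iff_le.2 fun μ hμ => (hF μ hμ).2
  have hf' : F' ∈ filt 𝕜 p 3 := mem_filt_iff_le.2 fun μ hμ => (hF' μ hμ).2
  have key : ∀ d, F - F' ∈ filt 𝕜 p (d + 3) := by
    intro d
    induction d with
    | zero => exact sub_mem hf hf'
    | succ d ih =>
      -- Both substitutions vanish, so the comparison bound applies to ∂_a(F - F') alone and gains
      -- one degree over the inductive hypothesis.
      have h1 : ∀ a, a ≠ o → pd a (F - F') ∈ filt 𝕜 p (d + 3) := by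
        intro a ha
        have h2 := opG_sub_opG_mem_filt (r := d + 1) (tame_lmul_pd hf) (tame_lmul_pd hf')
          (fun a => by
            rw [← lmul_sub, ← map_sub]
            exact raises_lmul (pd_mem_filt a ih))
          (truncWeyl_cl (hc.linear a ha)) (mem_filt_zero one)
        have h3 : opG _ (tame_lmul_pd hf) (cl (c a)) one = 0 :=
          Series.ext fun μ => congrFun (h a ha) μ
        have h4 : opG _ (tame_lmul_pd hf') (cl (c a)) one = 0 :=
          Series.ext fun μ => congrFun (h' a ha) μ
        rw [h3, h4, sub_zero, zero_sub, neg_mem_iff, lmul_one, lmul_one, ← map_sub] at h2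
        exact filt_anti (by omega) h2
      intro μ hμ
      by_contra h0
      have h3 : μ.2 = 0 ∧ 3 ≤ deg μ := by
        by_cases h4 : F.1 μ = 0
        · refine hF' μ fun h5 => h0 ?_
          have h5' : F'.1 μ = 0 := h5
          rw [Submodule.coe_sub, Pi.sub_apply, h4, h5', sub_zero]
        · exact hF μ h4
      -- Without ħ, a monomial in x^o alone has degree at most one because x^o is odd; degree three
      -- rules it out with no appeal to parity of F.
      have hw : weight o μ.1 ≠ 0 := by
        intro hw
        have h4 := eq_single_of_weight_eq_zero hw
        have h5 := (F - F').2.1 μ h0 o hc.odd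
        have h6 := congrArg Finsupp.degree h4
        rw [Finsupp.degree_single] at h6
        simp only [deg] at h3
        omega
      obtain ⟨a, hao, ha⟩ := exists_of_weight_ne_zero hw
      have h4 := h1 a hao (μ.1 - Finsupp.single a 1, μ.2) (by
        have := deg_sub_single ha
        omega)
      rw [coeff_pd_sub_single ha] at h4
      exact mul_ne_zero (mul_ne_zero (by exact_mod_cast ha) (koszul_cast_ne_zero _ _)) h0 h4
  exact eq_of_sub_mem_filt fun d => filt_anti (by omega) (key d)

end

end

section

variable {𝕜 : Type*} [Field 𝕜] {σ : Type*} [LinearOrder σ] {p : σ → ZMod 2}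

/-! ### Super quantum Airy structures -/

theorem opG_add {A : σ → Module.End 𝕜 (Series 𝕜 p)} (hA : Tame A) (c c' : Weyl 𝕜 p) :
    opG A hA (c + c') = opG A hA c + opG A hA c' := by
  refine LinearMap.ext fun f => Subtype.ext <| funext fun μ => ?_
  rw [LinearMap.add_apply, Submodule.coe_add, Pi.add_apply, opG_apply, opG_apply, opG_apply,
    ← finsum_add_distrib (hA.finite_support c f μ) (hA.finite_support c' f μ)]
  refine finsum_congr fun J => ?_
  rw [Pi.add_apply, lmul_add]
  rfl

theorem opG_smul {A : σ → Module.End 𝕜 (Series 𝕜 p)} (hA : Tame A) (r : 𝕜) (c : Weyl 𝕜 p) :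
    opG A hA (r • c) = r • opG A hA c := by
  refine LinearMap.ext fun f => Subtype.ext <| funext fun μ => ?_
  rw [LinearMap.smul_apply, Submodule.coe_smul, Pi.smul_apply, opG_apply, opG_apply, smul_finsum]
  refine finsum_congr fun J => ?_
  rw [Pi.smul_apply, lmul_smul]
  rfl

/-- `opG` as a linear map. -/
def opL (A : σ → Module.End 𝕜 (Series 𝕜 p)) (hA : Tame A) :
    Weyl 𝕜 p →ₗ[𝕜] Module.End 𝕜 (Series 𝕜 p) where
  toFun := opG A hA
  map_add' := opG_add hA
  map_smul' := opG_smul hA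

theorem raises_opG {A : σ → Module.End 𝕜 (Series 𝕜 p)} (hA : Tame A) (c : Weyl 𝕜 p) :
    Raises 0 (opG A hA c) := by
  intro d f hf μ hμ
  by_contra h
  obtain ⟨J, hJ⟩ := exists_of_finsum_ne_zero h
  have h1 := lmul_mem_filt (mem_filt_zero (c J)) (raises_orderedPow hA.raises J.1 d f hf)
  exact hJ (h1 μ (by omega))

variable (𝕜 p) in
/-- The unit of the completed Weyl algebra. -/
def weylOne : Weyl 𝕜 p := fun J => if J.1 = 0 then one else 0

theorem op_weylOne : op (weylOne 𝕜 p) = 1 := by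
  refine LinearMap.ext fun f => Series.ext fun μ => ?_
  rw [op_eq_opG, coeff, opG_apply, finsum_eq_single _ ⟨0, admissible_zero⟩]
  · have h : weylOne 𝕜 p ⟨0, admissible_zero⟩ = one := if_pos rfl
    rw [h, one_lmul, orderedPow_eq_wordProd]
    simp [word, wordProd, coeff]
  · intro J hJ
    have h : weylOne 𝕜 p J = 0 := if_neg fun h => hJ (Subtype.ext h)
    rw [h, lmul_zero]
    rfl

theorem opL_apply (A : σ → Module.End 𝕜 (Series 𝕜 p)) (hA : Tame A) (c : Weyl 𝕜 p) :
    opL A hA c = opG A hA c := rfl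

variable {V : Type*} [AddCommGroup V] [Module 𝕜 V] {ι : Type*}

theorem op_mem_leftIdeal (L : Module.Dual 𝕜 V →ₗ[𝕜] Weyl 𝕜 p) (φ : Module.Dual 𝕜 V) :
    op (L φ) ∈ leftIdeal L := by
  have h : op (L φ) = op (weylOne 𝕜 p) * op (L φ) := by
    rw [op_weylOne]
    rfl
  exact Submodule.subset_span ⟨_, φ, h⟩

/-- The part of a linear form supported on finitely many basis vectors. -/
def finitePart (x : Module.Basis ι 𝕜 V) (φ : Module.Dual 𝕜 V) (s : Finset ι) : Module.Dual 𝕜 V :=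
  ∑ i ∈ s, φ (x i) • x.coord i

theorem finitePart_apply_eq (x : Module.Basis ι 𝕜 V) (φ : Module.Dual 𝕜 V) {s : Finset ι} {v : V}
    (h : (x.repr v).support ⊆ s) : finitePart x φ s v = φ v := by
  have h1 : φ v = ∑ i ∈ (x.repr v).support, x.repr v i * φ (x i) := by
    conv_lhs => rw [← x.linearCombination_repr v]
    simp [Finsupp.linearCombination_apply, Finsupp.sum]
  rw [h1, finitePart, LinearMap.sum_apply]
  rw [sum_subset h]
  · refine sum_congr rfl fun i _ => ?_
    simp [mul_comm]
  · intro i _ hi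
    rw [Finsupp.notMem_support_iff.1 hi, zero_mul]

/-- The operators `L(y_i)`, extended by zero to the coordinate `x^0`. -/
def airyFamily [LinearOrder ι] {p : ι → ZMod 2} (x : Module.Basis ι 𝕜 V)
    (L : Module.Dual 𝕜 V →ₗ[𝕜] Weyl 𝕜 (tilde p)) : WithBot ι → Weyl 𝕜 (tilde p)
  | none => 0
  | some i => L (x.coord i)

/-- The part of v carried by basis vectors of parity p i is also v minus a sum of vectors of the
other parity, so it lies in both summands and is zero. Thus y_i has the parity of x^i. -/
theorem coord_eq_zero_of_mem {𝒱 : ZMod 2 → Submodule 𝕜 V} (h𝒱 : DirectSum.IsInternal 𝒱)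
    {x : Module.Basis ι 𝕜 V} {p : ι → ZMod 2} (hx : ∀ i, x i ∈ 𝒱 (p i)) (i : ι) {v : V}
    (hv : v ∈ 𝒱 (p i + 1)) : x.coord i v = 0 := by
  classical
  set S := (x.repr v).support with hS
  have hsum : v = ∑ j ∈ S, x.repr v j • x j := by
    conv_lhs => rw [← x.linearCombination_repr v]
    rfl
  have hsplit := sum_filter_add_sum_filter_not S (fun j => p j = p i) fun j => x.repr v j • x j
  rw [← hsum] at hsplit
  set v₀ := ∑ j ∈ S with p j = p i, x.repr v j • x j with hv₀
  have h0 : v₀ ∈ 𝒱 (p i) := sum_mem fun j hj => by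
    rw [← (mem_filter.1 hj).2]
    exact Submodule.smul_mem _ _ (hx j)
  have h1 : v₀ ∈ 𝒱 (p i + 1) := by
    rw [eq_sub_of_add_eq hsplit]
    refine sub_mem hv (sum_mem fun j hj => Submodule.smul_mem _ _ ?_)
    have h2 : p j = p i + 1 := by
      have := (mem_filter.1 hj).2
      revert this
      generalize p j = a
      generalize p i = b
      revert a b
      decide
    rw [← h2]
    exact hx j
  have hne : p i ≠ p i + 1 := by
    generalize p i = b
    revert b
    decide
  have h2 : v₀ = 0 := by
    have := (h𝒱.submodule_iSupIndep.pairwiseDisjoint hne).le_bot ⟨h0, h1⟩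
    simpa using this
  have h3 : x.repr v₀ i = if i ∈ S then x.repr v i else 0 := by
    rw [hv₀, map_sum, Finsupp.finsetSum_apply]
    simp [Finsupp.single_apply]
  rw [h2] at h3
  rw [Module.Basis.coord_apply]
  by_cases hi : i ∈ S
  · simpa [hi] using h3.symm
  · exact Finsupp.notMem_support_iff.1 hi

section

variable [CharZero 𝕜] [LinearOrder ι] {𝒱 : ZMod 2 → Submodule 𝕜 V} {x : Module.Basis ι 𝕜 V}
  {p : ι → ZMod 2} {L : Module.Dual 𝕜 V →ₗ[𝕜] Weyl 𝕜 (tilde p)}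

theorem IsSuperQuantumAiry.isAirySystem (h𝒱 : DirectSum.IsInternal 𝒱) (hx : ∀ i, x i ∈ 𝒱 (p i))
    (hL : IsSuperQuantumAiry 𝒱 x p L) : IsAirySystem ⊥ (airyFamily x L) where
  odd := rfl
  linear a ha := by
    obtain ⟨i, rfl⟩ := WithBot.ne_bot_iff_exists.1 ha
    exact hL.linear_part i
  parity a := by
    induction a using WithBot.recBotCoe with
    | bot => exact fun J μ h => absurd rfl h
    | coe i => exact hL.even (p i) (x.coord i) fun v hv => coord_eq_zero_of_mem h𝒱 hx i hv
  tendsto f d := by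
    classical
    -- Only coordinates in the supports of the finitely many vectors of s can be nonzero on s, so
    -- all other L(y_i) send f to degree at least d.
    obtain ⟨s, hs⟩ := hL.continuous f d
    rw [Filter.eventually_cofinite]
    refine ((s.biUnion fun v => (x.repr v).support).finite_toSet.image
      (fun i : ι => (i : WithBot ι))).subset ?_
    intro a ha
    induction a using WithBot.recBotCoe with
    | bot =>
      refine absurd ?_ ha
      have h0 : op (airyFamily x L ⊥) = 0 := map_zero (opL _ tame_hbar_pd)
      change op (airyFamily x L ⊥) f - 0 ∈ _
      rw [h0, sub_zero]
      exact zero_mem _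
    | coe i =>
      refine ⟨i, ?_, rfl⟩
      by_contra hi
      refine ha ?_
      rw [LinearMap.zero_apply, sub_zero]
      refine hs (x.coord i) fun v hv => ?_
      rw [Module.Basis.coord_apply]
      by_contra h
      exact hi (by
        rw [Finset.mem_coe, mem_biUnion]
        exact ⟨v, hv, Finsupp.mem_support_iff.2 h⟩)

/-- By continuity, it suffices to control the operators `L(y_i)`. -/
theorem IsSuperQuantumAiry.mem_filt_of_coord (hL : IsSuperQuantumAiry 𝒱 x p L)
    {F : Series 𝕜 (tilde p)} (hF : IsPotential F) {n : ℕ}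
    (h : ∀ a, a ≠ ⊥ → residue (airyFamily x L) F hF a ∈ filt 𝕜 (tilde p) n)
    (φ : Module.Dual 𝕜 V) :
    opG (conjPd F) (tame_conjPd hF.mem_filt) (L φ) one ∈ filt 𝕜 (tilde p) n := by
  classical
  -- A finite part of φ agrees with φ on any prescribed finite set of vectors once it includes their
  -- supports.
  have hlim : TendstoPt Filter.atTop (fun s => op (L (finitePart x φ s))) (op (L φ)) := by
    intro f d
    obtain ⟨s, hs⟩ := hL.continuous f d
    filter_upwards [Filter.eventually_ge_atTop (s.biUnion fun v => (x.repr v).support)] with t ht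
    have e : op (L (finitePart x φ t)) f - op (L φ) f = op (L (finitePart x φ t - φ)) f := by
      have := map_sub (opL _ tame_hbar_pd ∘ₗ L) (finitePart x φ t) φ
      exact (LinearMap.congr_fun this f).symm
    rw [e]
    refine hs _ fun v hv => ?_
    rw [LinearMap.sub_apply, finitePart_apply_eq, sub_self]
    exact (subset_biUnion_of_mem (fun v => (x.repr v).support) hv).trans ht
  obtain ⟨s, hs⟩ := (Conj.tendstoPt (fun s => conj_op hF.homog hF.mem_filt _)
    (conj_op hF.homog hF.mem_filt (L φ)) hlim one n).exists
  have h1 : opG (conjPd F) (tame_conjPd hF.mem_filt) (L (finitePart x φ s)) one ∈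
      filt 𝕜 (tilde p) n := by
    have e : opG (conjPd F) (tame_conjPd hF.mem_filt) (L (finitePart x φ s)) one =
        ∑ i ∈ s, φ (x i) • residue (airyFamily x L) F hF (i : WithBot ι) := by
      rw [← opL_apply, finitePart, map_sum, map_sum, LinearMap.sum_apply]
      refine sum_congr rfl fun i _ => ?_
      rw [map_smul, map_smul]
      rfl
    rw [e]
    exact sum_mem fun i _ => Submodule.smul_mem _ _ (h i (WithBot.coe_ne_bot))
  have := sub_mem h1 hs
  rwa [sub_sub_cancel] at this

/-- In a left ideal the factor L(φ) acts on 1 first, giving degree at least n, and conjugates of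
Weyl operators never lower the degree. -/
theorem IsSuperQuantumAiry.exists_conj_of_mem_leftIdeal (hL : IsSuperQuantumAiry 𝒱 x p L)
    {F : Series 𝕜 (tilde p)} (hF : IsPotential F) {n : ℕ}
    (h : ∀ a, a ≠ ⊥ → residue (airyFamily x L) F hF a ∈ filt 𝕜 (tilde p) n)
    {U : Module.End 𝕜 (Series 𝕜 (tilde p))} (hU : U ∈ leftIdeal L) :
    ∃ U', Conj F U U' ∧ U' one ∈ filt 𝕜 (tilde p) n := by
  unfold leftIdeal at hU
  induction hU using Submodule.span_induction with
  | mem T hT =>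
    obtain ⟨a, φ, rfl⟩ := hT
    refine ⟨_, (conj_op hF.homog hF.mem_filt a).mul (conj_op hF.homog hF.mem_filt (L φ)), ?_⟩
    rw [Module.End.mul_apply]
    exact raises_opG (tame_conjPd hF.mem_filt) a n _ (hL.mem_filt_of_coord hF h φ)
  | zero => exact ⟨0, conj_zero F, zero_mem _⟩
  | add S T _ _ hS hT =>
    obtain ⟨S', hS, hS1⟩ := hS
    obtain ⟨T', hT, hT1⟩ := hT
    refine ⟨S' + T', hS.add hT, ?_⟩
    rw [LinearMap.add_apply]
    exact add_mem hS1 hT1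
  | smul r T _ hT =>
    obtain ⟨T', hT, hT1⟩ := hT
    refine ⟨r • T', hT.smul r, ?_⟩
    rw [LinearMap.smul_apply]
    exact Submodule.smul_mem _ _ hT1

theorem IsPotential.psi_eq_zero_iff {F : Series 𝕜 (tilde p)} (hF : IsPotential F)
    (c : Weyl 𝕜 (tilde p)) : psi F (op c) one = 0 ↔
      opG (conjPd F) (tame_conjPd hF.mem_filt) c one = 0 := by
  rw [(conj_op hF.homog hF.mem_filt c).psi_eq hF.homog]
  exact ⟨fun h => Series.ext fun μ => congrFun h μ, fun h => by rw [h]; rfl⟩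

/-- Vanishing of all residues trivially gives a fixed point; the converse is where involutivity
enters, followed by continuity to pass from the y_i to every φ. -/
theorem isFreeEnergy_iff (h𝒱 : DirectSum.IsInternal 𝒱) (hx : ∀ i, x i ∈ 𝒱 (p i))
    (hL : IsSuperQuantumAiry 𝒱 x p L) (F : Series 𝕜 (tilde p)) :
    IsFreeEnergy L F ↔ ∃ hF : IsPotential F,
      nextPotential (hL.isAirySystem h𝒱 hx) F hF = F := by
  constructor
  · rintro ⟨hF, h⟩
    have hF : IsPotential F := hF
    refine ⟨hF, nextPotential_eq_of_residue_eq_zero _ hF fun a ha => ?_⟩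
    obtain ⟨i, rfl⟩ := WithBot.ne_bot_iff_exists.1 ha
    exact (hF.psi_eq_zero_iff _).1 (h (x.coord i))
  · rintro ⟨hF, h⟩
    refine ⟨hF, fun φ => (hF.psi_eq_zero_iff _).2 ?_⟩
    have hres : ∀ a, a ≠ ⊥ → residue (airyFamily x L) F hF a = 0 := by
      intro a ha
      refine residue_eq_zero (hL.isAirySystem h𝒱 hx) hF h (fun n hn a b ha hb => ?_) ha
      obtain ⟨i, rfl⟩ := WithBot.ne_bot_iff_exists.1 ha
      obtain ⟨j, rfl⟩ := WithBot.ne_bot_iff_exists.1 hb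
      have hmem : ∀ i, op (L (x.coord i)) ∈ leftIdeal L := fun i =>
        op_mem_leftIdeal L (x.coord i)
      obtain ⟨U, hU, e⟩ := hL.involutive _ (hmem i) _ (hmem j)
      suffices h1 : ∃ U', Conj F U U' ∧ U' one ∈ filt 𝕜 (tilde p) n by
        obtain ⟨U', h1⟩ := h1
        exact ⟨U, U', e, h1⟩
      exact hL.exists_conj_of_mem_leftIdeal hF hn hU
    exact eq_zero_of_mem_filt fun n => hL.mem_filt_of_coord hF
      (fun a ha => by rw [hres a ha]; exact zero_mem _) φ

/-- The classical limit of a free energy solves the classical equations. -/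
theorem IsFreeEnergy.isClassicalSolution {F : Series 𝕜 (tilde p)} (h : IsFreeEnergy L F) :
    IsClassicalSolution x L (clSeries F) := by
  have hF : IsPotential F := h.1
  refine ⟨fun μ hμ => ?_, fun i => ?_⟩
  · simp only [coeff, clSeries] at hμ
    split_ifs at hμ with h0
    · exact ⟨h0, (hF μ hμ).2.2⟩
    · exact absurd rfl hμ
  · rw [substD_cl hF.mem_filt, (hF.psi_eq_zero_iff _).1 (h.2 (x.coord i))]
    funext μ
    simp [coeff, clSeries]

theorem IsClassicalSolution.eq (h𝒱 : DirectSum.IsInternal 𝒱) (hx : ∀ i, x i ∈ 𝒱 (p i))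
    (hL : IsSuperQuantumAiry 𝒱 x p L) {F F' : Series 𝕜 (tilde p)}
    (hF : IsClassicalSolution x L F) (hF' : IsClassicalSolution x L F') : F = F' := by
  refine classical_unique (hL.isAirySystem h𝒱 hx) hF.1 hF'.1 (fun a ha => ?_) (fun a ha => ?_)
  · obtain ⟨i, rfl⟩ := WithBot.ne_bot_iff_exists.1 ha
    exact hF.2 i
  · obtain ⟨i, rfl⟩ := WithBot.ne_bot_iff_exists.1 ha
    exact hF'.2 i

end

end

end SuperAiry

end

theorem mainTheorem3 {𝕜 : Type*} [RCLike 𝕜] {V : Type*} [AddCommGroup V] [Module 𝕜 V]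
    (𝒱 : ZMod 2 → Submodule 𝕜 V) (h𝒱 : DirectSum.IsInternal 𝒱)
    {ι : Type*} [LinearOrder ι] (x : Module.Basis ι 𝕜 V) (p : ι → ZMod 2)
    (hx : ∀ i, x i ∈ 𝒱 (p i))
    (L : Module.Dual 𝕜 V →ₗ[𝕜] SuperAiry.Weyl 𝕜 (SuperAiry.tilde p))
    (hL : SuperAiry.IsSuperQuantumAiry 𝒱 x p L) :
    (∃! Fcl, SuperAiry.IsClassicalSolution x L Fcl) ∧
    (∃! F, SuperAiry.IsFreeEnergy L F) ∧
    (∀ Fcl F, SuperAiry.IsClassicalSolution x L Fcl → SuperAiry.IsFreeEnergy L F →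
      Fcl = SuperAiry.clSeries F) := by
  have hcl := SuperAiry.isFreeEnergy_iff h𝒱 hx hL
  obtain ⟨F, hF, hfix⟩ := SuperAiry.exists_nextPotential_eq (hL.isAirySystem h𝒱 hx)
  have hfree : SuperAiry.IsFreeEnergy L F := (hcl F).2 ⟨hF, hfix⟩
  refine ⟨⟨SuperAiry.clSeries F, hfree.isClassicalSolution, fun G hG =>
    hG.eq h𝒱 hx hL hfree.isClassicalSolution⟩, ⟨F, hfree, fun G hG => ?_⟩,
    fun Fcl G hFcl hG => hFcl.eq h𝒱 hx hL hG.isClassicalSolution⟩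
  obtain ⟨hG, hGfix⟩ := (hcl G).1 hG
  exact SuperAiry.eq_of_nextPotential_eq (hL.isAirySystem h𝒱 hx) hG hF hGfix hfix
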